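/- Let $\mathbb F$ be a field and let $q\in\mathbb F$ be nonzero and not a root of unity. Write $[n]_q=\frac{q^n-q^{-n}}{q-q^{-1}}$ and $[n]_q^!=[n]_q[n-1]_q\cdots[1]_q$, with $[0]_q^!=1$. Let $U=U_q(\mathfrak{sl}_2)$ be the $\mathbb F$-algebra with generators $e,f,k^{\pm1}$ and relations $kk^{-1}=k^{-1}k=1$, $ke=q^2ek$, $kf=q^{-2}fk$, $ef-fe=\frac{k-k^{-1}}{q-q^{-1}}$. For $0\neq\theta\in\mathbb F$ and $t\in\mathbb Z$, identify $U$ with the algebra given by generators $x,y^{\pm1},z$ and relations $yy^{-1}=y^{-1}y=1$, $\frac{qxy-q^{-1}yx}{q-q^{-1}}=\frac{qyz-q^{-1}zy}{q-q^{-1}}=\frac{qzx-q^{-1}xz}{q-q^{-1}}=1$, through one of two isomorphisms: the primary identification of type $(\theta,t)$, $$x\mapsto k^{-1}-k^{-1-t}e\,q^{1+t}(q-q^{-1})\theta^{-1},\qquad y^{\pm1}\mapsto k^{\pm1},\qquad z\mapsto k^{-1}+fk^t\,q^{-t}(q-q^{-1})\theta,$$ or the secondary identification of type $(\theta,t)$,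 $$x\mapsto k-k^{1+t}f\,q^{1+t}(q-q^{-1})\theta^{-1},\qquad y^{\pm1}\mapsto k^{\mp1},\qquad z\mapsto k+ek^{-t}\,q^{-t}(q-q^{-1})\theta.$$ Put $n_x=\frac{q(1-yz)}{q-q^{-1}}$ and $n_z=\frac{q(1-xy)}{q-q^{-1}}$. A finite-dimensional $U$-module $V$ has type 1 if $V\neq0$ and $V$ is a direct sum of irreducible submodules, each of which has, for some $d\in\mathbb N$, a basis $v_0,\dots,v_d$ with $kv_i=q^{d-2i}v_i$, $fv_i=[i+1]_qv_{i+1}$ for $i<d$, $fv_d=0$, $ev_i=[d-i+1]_qv_{i-1}$ for $i\geq1$, $ev_0=0$. Such a $V$ is the direct sum of its weight spaces $V(\lambda)=\{v\in V: kv=q^\lambda v\}$, $\lambda\in\mathbb Z$. The Lusztig operators $T,T^\vee$ are the linear operators on $V$ that act on each $V(\lambda)$ as $$T=\sum_{\substack{a,b,c\in\mathbb N\\ b-a-c=\lambda}}\frac{e^af^be^c}{[a]_q^![b]_q^![c]_q^!}(-1)^bq^{b-ac},\qquad T^\vee=\sum_{\substack{a,b,c\in\mathbb N\\ a-b+c=\lambda}}\frac{f^ae^bf^c}{[a]_q^![b]_q^![c]_q^!}(-1)^bq^{b-ac}.$$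 For a nilpotent operator $\varphi$ put $\exp_q(\varphi)=\sum_{i\in\mathbb N}\frac{q^{\binom i2}}{[i]_q^!}\varphi^i$. Suppose that $\theta^2=q$ or $\theta^2=q^{-1}$, and put $q^{1/2}=-\theta$ if $\theta^2=q$ and $q^{1/2}=\theta^{-1}$ if $\theta^2=q^{-1}$. Let $\Upsilon$ be the linear operator that acts on each $V(\lambda)$ as the scalar $q^{-\lambda^2/2}=(q^{1/2})^{-\lambda^2}$, and put $\mathfrak R=\exp_q(n_x)\,\Upsilon\,\exp_q(n_z)$. Then, for every $t\in\mathbb Z$ and on every finite-dimensional $U$-module of type 1, $T$ and $T^\vee$ are invertible and the following hold: - if $\theta^2=q$, then $T^{-1}=\exp_q(n_z)\,\mathfrak R$ under the primary identification of type $(\theta,t)$, and $(T^\vee)^{-1}=\exp_q(n_z)\,\mathfrak R$ under the secondary identification of type $(\theta,t)$; - if $\theta^2=q^{-1}$, then $(T^\vee)^{-1}=\exp_q(n_z)\,\mathfrak R$ under the primary identification of type $(\theta,t)$, and $T^{-1}=\exp_q(n_z)\,\mathfrak R$ under the secondary identification of type $(\theta,t)$. -/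

import Mathlib

namespace QSl2

section Scalars

variable {F : Type*} [Field F]

/-- The standing assumption on the parameter: `q` is nonzero and not a root of unity. -/
structure IsGeneric (q : F) : Prop where
  ne_zero : q ≠ 0
  not_root : ∀ n : ℕ, 0 < n → q ^ n ≠ 1

/-- The `q`-integer `[n]_q = (q^n - q^{-n}) / (q - q^{-1})`. -/
def qInt (q : F) (n : ℤ) : F := (q ^ n - q ^ (-n)) / (q - q⁻¹)

/-- The `q`-factorial `[n]_q! = [1]_q [2]_q ... [n]_q`, with `[0]_q! = 1`. -/
def qFact (q : F) (n : ℕ) : F := ∏ i ∈ Finset.range n, qInt q ((i : ℤ) + 1)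

theorem IsGeneric.sub_inv_ne_zero {q : F} (hq : IsGeneric q) : q - q⁻¹ ≠ 0 := by
  intro h
  have h2 := hq.not_root 2 (by norm_num)
  have h0 := hq.ne_zero
  apply h2
  field_simp at h
  linear_combination h

theorem IsGeneric.zpow_injective {q : F} (hq : IsGeneric q) :
    Function.Injective (fun n : ℤ => q ^ n) := by
  have key : ∀ a b : ℤ, a < b → q ^ a ≠ q ^ b := by
    intro a b hab h
    have h0 := hq.ne_zero
    obtain ⟨n, hn⟩ := Int.eq_ofNat_of_zero_le (show 0 ≤ b - a by omega)
    apply hq.not_root n (by omega)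
    rw [← zpow_natCast, ← hn, zpow_sub₀ h0, h, div_self (zpow_ne_zero _ h0)]
  intro a b h
  rcases lt_trichotomy a b with hab | hab | hab
  · exact absurd h (key a b hab)
  · exact hab
  · exact absurd h.symm (key b a hab)

end Scalars

section Relations

variable {F : Type*} [Field F] {A : Type*} [Ring A] [Algebra F A]

/-- The defining relations of the Chevalley presentation, for elements `e`, `f` and a unit `k`
of an algebra. -/
structure ChevalleyRel (q : F) (e f : A) (k : Aˣ) : Prop where
  ke : (k : A) * e = q ^ 2 • (e * k)
  kf : (k : A) * f = (q⁻¹) ^ 2 • (f * k)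
  ef : e * f - f * e = (q - q⁻¹)⁻¹ • ((k : A) - ((k⁻¹ : Aˣ) : A))

/-- The defining relations of the equitable presentation, for elements `x`, `z` and a unit `y`
of an algebra. -/
structure EquitableRel (q : F) (x : A) (y : Aˣ) (z : A) : Prop where
  xy : (q - q⁻¹)⁻¹ • (q • (x * y) - q⁻¹ • ((y : A) * x)) = 1
  yz : (q - q⁻¹)⁻¹ • (q • ((y : A) * z) - q⁻¹ • (z * y)) = 1
  zx : (q - q⁻¹)⁻¹ • (q • (z * x) - q⁻¹ • (x * z)) = 1

/-- Interchanging `e` with `f` and `k` with its inverse preserves the Chevalley relations. -/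
theorem ChevalleyRel.swap {q : F} (hq : q ≠ 0) {e f : A} {k : Aˣ} (h : ChevalleyRel q e f k) :
    ChevalleyRel q f e k⁻¹ where
  ke := by
    rw [Units.inv_mul_eq_iff_eq_mul, mul_smul_comm, ← mul_assoc, h.kf]
    simp [smul_smul, mul_assoc, hq]
  kf := by
    rw [Units.inv_mul_eq_iff_eq_mul, mul_smul_comm, ← mul_assoc, h.ke]
    simp [smul_smul, mul_assoc, hq]
  ef := by
    have := h.ef
    rw [inv_inv, ← neg_sub (e * f), this, ← smul_neg, neg_sub]

theorem zpow_comm_of_comm {a : F} (ha : a ≠ 0) {k : Aˣ} {e : A}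
    (h : (k : A) * e = a • (e * k)) (n : ℤ) :
    ((k ^ n : Aˣ) : A) * e = a ^ n • (e * ((k ^ n : Aˣ) : A)) := by
  have h' : ((k⁻¹ : Aˣ) : A) * e = a⁻¹ • (e * ((k⁻¹ : Aˣ) : A)) := by
    rw [Units.inv_mul_eq_iff_eq_mul, mul_smul_comm, ← mul_assoc, h]
    simp [smul_smul, mul_assoc, ha]
  induction n using Int.induction_on with
  | zero => simp
  | succ n ih =>
    rw [zpow_add_one, Units.val_mul, mul_assoc, h, mul_smul_comm, ← mul_assoc, ih, smul_mul_assoc,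
      smul_smul, mul_assoc, zpow_add_one₀ ha, mul_comm a]
  | pred n ih =>
    rw [zpow_sub_one, Units.val_mul, mul_assoc, h', mul_smul_comm, ← mul_assoc, ih, smul_mul_assoc,
      smul_smul, mul_assoc, zpow_sub_one₀ ha, mul_comm a⁻¹]

/-- Chevalley generators give equitable generators. -/
theorem ChevalleyRel.equitable {q : F} (hq : IsGeneric q) {θ : F} (hθ : θ ≠ 0) (t : ℤ)
    {e f : A} {k : Aˣ} (h : ChevalleyRel q e f k) :
    EquitableRel q
      (((k⁻¹ : Aˣ) : A) - (q ^ (1 + t) * (q - q⁻¹) * θ⁻¹) • (((k ^ (-1 - t) : Aˣ) : A) * e))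
      k
      (((k⁻¹ : Aˣ) : A) + (q ^ (-t) * (q - q⁻¹) * θ) • (f * ((k ^ t : Aˣ) : A))) := by
  have h0 := hq.ne_zero
  have h1 := hq.sub_inv_ne_zero
  -- The products that occur, with every power of `k` written as one power.
  have e1 := zpow_comm_of_comm (pow_ne_zero 2 h0) h.ke
  have f1 := zpow_comm_of_comm (pow_ne_zero 2 (inv_ne_zero h0)) h.kf
  have e2 : ∀ (n : ℤ) (b : A), ((k ^ n : Aˣ) : A) * (e * b)
      = (q ^ 2) ^ n • (e * (((k ^ n : Aˣ) : A) * b)) := fun n b => by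
    rw [← mul_assoc, e1, smul_mul_assoc, mul_assoc]
  have f2 : ∀ (n : ℤ) (b : A), ((k ^ n : Aˣ) : A) * (f * b)
      = ((q⁻¹) ^ 2) ^ n • (f * (((k ^ n : Aˣ) : A) * b)) := fun n b => by
    rw [← mul_assoc, f1, smul_mul_assoc, mul_assoc]
  have kk : ∀ m n : ℤ, ((k ^ m : Aˣ) : A) * ((k ^ n : Aˣ) : A) = ((k ^ (m + n) : Aˣ) : A) :=
    fun m n => by rw [← Units.val_mul, ← zpow_add]
  have fe : f * e = e * f - (q - q⁻¹)⁻¹ • (((k ^ (1 : ℤ) : Aˣ) : A) - ((k ^ (-1 : ℤ) : Aˣ) : A)) := by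
    rw [zpow_one, zpow_neg_one, ← h.ef]; abel
  have fe2 : ∀ b : A, f * (e * b) = e * (f * b)
      - (q - q⁻¹)⁻¹ • (((k ^ (1 : ℤ) : Aˣ) : A) * b - ((k ^ (-1 : ℤ) : Aˣ) : A) * b) := fun b => by
    rw [← mul_assoc, fe, sub_mul, smul_mul_assoc, sub_mul, mul_assoc]
  have hk : (k : A) = ((k ^ (1 : ℤ) : Aˣ) : A) := by rw [zpow_one]
  have hk' : ((k⁻¹ : Aˣ) : A) = ((k ^ (-1 : ℤ) : Aˣ) : A) := by rw [zpow_neg_one]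
  have hone : (1 : A) = ((k ^ (0 : ℤ) : Aˣ) : A) := by simp
  have hp : q ^ t ≠ 0 := zpow_ne_zero _ h0
  have hd : q ^ 2 - 1 ≠ 0 := sub_ne_zero.mpr (hq.not_root 2 (by norm_num))
  have z1 : q ^ (1 + t) = q * q ^ t := zpow_one_add₀ h0 t
  have z2 : q ^ (-t) = (q ^ t)⁻¹ := zpow_neg q t
  have z3 : (q ^ 2) ^ t = (q ^ t) ^ 2 := by rw [← zpow_natCast, ← zpow_natCast, zpow_comm]
  have z4 : (q ^ 2) ^ (-1 - t) = (q ^ 2)⁻¹ * ((q ^ t) ^ 2)⁻¹ := by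
    rw [zpow_sub₀ (pow_ne_zero 2 h0), z3, zpow_neg_one, div_eq_mul_inv]
  have z5 : (q⁻¹ ^ 2) ^ (-1 - t) = q ^ 2 * (q ^ t) ^ 2 := by
    rw [inv_pow, inv_zpow, z4, mul_inv, inv_inv, inv_inv]
  constructor
  all_goals
    rw [inv_smul_eq_iff₀ h1, hk', hone]
    try rw [hk]
    simp only [mul_add, mul_sub, add_mul, sub_mul, smul_mul_assoc, mul_smul_comm, smul_smul,
      smul_add, smul_sub, mul_assoc, e1, e2, f2, kk, fe2]
    ring_nf
    try match_scalars
  all_goals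
    try simp only [z1, z2, z3, z4, z5, zpow_one, zpow_neg_one]
    try field_simp
    try ring

/-- Equitable generators give Chevalley generators. -/
theorem EquitableRel.chevalley {q : F} (hq : IsGeneric q) {θ : F} (hθ : θ ≠ 0) (t : ℤ)
    {x z : A} {y : Aˣ} (h : EquitableRel q x y z) :
    ChevalleyRel q
      ((q ^ (-1 - t) * (q - q⁻¹)⁻¹ * θ) • (((y ^ t : Aˣ) : A) * (1 - (y : A) * x)))
      ((q ^ t * (q - q⁻¹)⁻¹ * θ⁻¹) • ((z - ((y⁻¹ : Aˣ) : A)) * ((y ^ (-t) : Aˣ) : A)))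
      y := by
  have h0 := hq.ne_zero
  have h1 := hq.sub_inv_ne_zero
  have hp : q ^ t ≠ 0 := zpow_ne_zero _ h0
  have hd : q ^ 2 - 1 ≠ 0 := sub_ne_zero.mpr (hq.not_root 2 (by norm_num))
  have hxy := (inv_smul_eq_iff₀ h1).1 h.xy
  have hyz := (inv_smul_eq_iff₀ h1).1 h.yz
  have hzx := (inv_smul_eq_iff₀ h1).1 h.zx
  have z3 : (q ^ 2) ^ t = (q ^ t) ^ 2 := by rw [← zpow_natCast, ← zpow_natCast, zpow_comm]
  have z6 : (q⁻¹ ^ 2) ^ t = ((q ^ t) ^ 2)⁻¹ := by rw [inv_pow, inv_zpow, z3]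
  have z7 : q ^ (-1 - t) = q⁻¹ * (q ^ t)⁻¹ := by
    rw [zpow_sub₀ h0, zpow_neg_one, div_eq_mul_inv]
  -- Write `x` and `z` through two elements that commute with `y` up to a scalar.
  obtain ⟨a, ha⟩ : ∃ a, a = 1 - (y : A) * x := ⟨_, rfl⟩
  obtain ⟨b, hb⟩ : ∃ b, b = z - ((y⁻¹ : Aˣ) : A) := ⟨_, rfl⟩
  have hx : x = ((y⁻¹ : Aˣ) : A) * (1 - a) := by rw [ha, sub_sub_cancel, Units.inv_mul_cancel_left]
  have hz : z = b + ((y⁻¹ : Aˣ) : A) := by rw [hb, sub_add_cancel]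
  have ya : (y : A) * a = q ^ 2 • (a * y) := by
    have : x * (y : A) = (q⁻¹) • ((q - q⁻¹) • (1 : A) + q⁻¹ • ((y : A) * x)) := by
      rw [← hxy, sub_add_cancel, smul_smul, inv_mul_cancel₀ h0, one_smul]
    rw [ha, mul_sub, sub_mul, mul_assoc, this]
    simp only [mul_smul_comm, mul_add, smul_add, smul_sub, smul_smul, mul_one, one_mul]
    match_scalars <;> field_simp <;> ring
  have yb : (y : A) * b = (q⁻¹) ^ 2 • (b * y) := by
    have : (y : A) * z = (q⁻¹) • ((q - q⁻¹) • (1 : A) + q⁻¹ • (z * (y : A))) := by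
      rw [← hyz, sub_add_cancel, smul_smul, inv_mul_cancel₀ h0, one_smul]
    rw [hb, mul_sub, sub_mul, this, Units.mul_inv, Units.inv_mul]
    simp only [smul_add, smul_sub, smul_smul]
    match_scalars <;> field_simp <;> ring
  rw [← ha, ← hb]
  have a1 := zpow_comm_of_comm (pow_ne_zero 2 h0) ya
  have b1 := zpow_comm_of_comm (pow_ne_zero 2 (inv_ne_zero h0)) yb
  have a2 : ∀ (n : ℤ) (c : A), ((y ^ n : Aˣ) : A) * (a * c)
      = (q ^ 2) ^ n • (a * (((y ^ n : Aˣ) : A) * c)) := fun n c => by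
    rw [← mul_assoc, a1, smul_mul_assoc, mul_assoc]
  have b2 : ∀ (n : ℤ) (c : A), ((y ^ n : Aˣ) : A) * (b * c)
      = ((q⁻¹) ^ 2) ^ n • (b * (((y ^ n : Aˣ) : A) * c)) := fun n c => by
    rw [← mul_assoc, b1, smul_mul_assoc, mul_assoc]
  have kk : ∀ m n : ℤ, ((y ^ m : Aˣ) : A) * ((y ^ n : Aˣ) : A) = ((y ^ (m + n) : Aˣ) : A) :=
    fun m n => by rw [← Units.val_mul, ← zpow_add]
  have kk2 : ∀ (m n : ℤ) (c : A), ((y ^ m : Aˣ) : A) * (((y ^ n : Aˣ) : A) * c)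
      = ((y ^ (m + n) : Aˣ) : A) * c := fun m n c => by rw [← mul_assoc, kk]
  have hy : (y : A) = ((y ^ (1 : ℤ) : Aˣ) : A) := by rw [zpow_one]
  have hy' : ((y⁻¹ : Aˣ) : A) = ((y ^ (-1 : ℤ) : Aˣ) : A) := by rw [zpow_neg_one]
  have hone : ((y ^ (0 : ℤ) : Aˣ) : A) = 1 := by simp
  have ab : a * b = b * a + (q * (q - q⁻¹)) • ((y : A) - ((y⁻¹ : Aˣ) : A)) := by
    have key := congrArg (fun w => q • ((y : A) * w)) hzx
    rw [hx, hz, hy', hy] at key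
    simp only [mul_add, mul_sub, add_mul, sub_mul, smul_mul_assoc, mul_smul_comm, smul_smul,
      smul_add, smul_sub, mul_assoc, a1, a2, b1, b2, kk, mul_one] at key
    norm_num only [hone, mul_one, zpow_one, zpow_neg_one] at key
    have key2 : a * b - (b * a + (q * (q - q⁻¹)) • ((y : A) - ((y⁻¹ : Aˣ) : A))) = 0 := by
      rw [← sub_eq_zero] at key
      rw [← key]
      match_scalars <;> field_simp <;> ring
    exact sub_eq_zero.1 key2
  constructor
  · rw [hy]
    simp only [mul_assoc, kk, a1, a2, smul_smul, mul_smul_comm, smul_mul_assoc, zpow_one (q ^ 2),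
      add_comm t 1]
    module
  · rw [hy]
    simp only [mul_assoc, kk, b2, smul_smul, mul_smul_comm, smul_mul_assoc, zpow_one (q⁻¹ ^ 2),
      add_comm (-t) 1]
    module
  · have e1 : ((y ^ t : Aˣ) : A) * a * (b * ((y ^ (-t) : Aˣ) : A)) = a * b := by
      simp only [mul_assoc, a2, b2, mul_smul_comm, smul_smul, kk, z3, z6]
      rw [mul_inv_cancel₀ (pow_ne_zero 2 hp)]
      simp
    have e2 : (b * ((y ^ (-t) : Aˣ) : A)) * (((y ^ t : Aˣ) : A) * a) = b * a := by
      simp only [mul_assoc, kk2, neg_add_cancel, hone, one_mul]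
    rw [smul_mul_smul_comm, smul_mul_smul_comm, e1, e2, ab, z7]
    match_scalars <;> field_simp <;> ring


end Relations

section Inverses

variable {F : Type*} [Field F] {A : Type*} [Ring A] [Algebra F A]

theorem chevalley_e_of_equitable {q : F} (hq : IsGeneric q) {θ : F} (hθ : θ ≠ 0) (t : ℤ)
    (e : A) (k : Aˣ) :
    (q ^ (-1 - t) * (q - q⁻¹)⁻¹ * θ) • (((k ^ t : Aˣ) : A) * (1 - (k : A) *
      (((k⁻¹ : Aˣ) : A) - (q ^ (1 + t) * (q - q⁻¹) * θ⁻¹) • (((k ^ (-1 - t) : Aˣ) : A) * e)))) =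
      e := by
  have h0 := hq.ne_zero
  have h1 := hq.sub_inv_ne_zero
  have hk : ((k ^ t : Aˣ) : A) * ((k : A) * ((k ^ (-1 - t) : Aˣ) : A)) = 1 := by
    rw [← Units.val_mul, ← Units.val_mul, ← zpow_one_add, ← zpow_add,
      show t + (1 + (-1 - t)) = 0 by ring, zpow_zero, Units.val_one]
  have hc : q ^ (-1 - t) * (q - q⁻¹)⁻¹ * θ * (q ^ (1 + t) * (q - q⁻¹) * θ⁻¹) = 1 := by
    rw [show -1 - t = -(1 + t) by ring, zpow_neg]
    have := zpow_ne_zero (1 + t) h0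
    rw [show (q ^ (1 + t))⁻¹ * (q - q⁻¹)⁻¹ * θ * (q ^ (1 + t) * (q - q⁻¹) * θ⁻¹) =
      ((q ^ (1 + t))⁻¹ * q ^ (1 + t)) * ((q - q⁻¹)⁻¹ * (q - q⁻¹)) * (θ * θ⁻¹) by ring,
      inv_mul_cancel₀ this, inv_mul_cancel₀ h1, mul_inv_cancel₀ hθ, one_mul, one_mul]
  rw [mul_sub (k : A), Units.mul_inv, sub_sub_cancel, mul_smul_comm, mul_smul_comm, smul_smul, hc,
    one_smul, ← mul_assoc, ← mul_assoc, mul_assoc _ (k : A), hk, one_mul]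

theorem chevalley_f_of_equitable {q : F} (hq : IsGeneric q) {θ : F} (hθ : θ ≠ 0) (t : ℤ)
    (f : A) (k : Aˣ) :
    (q ^ t * (q - q⁻¹)⁻¹ * θ⁻¹) • (((((k⁻¹ : Aˣ) : A) +
      (q ^ (-t) * (q - q⁻¹) * θ) • (f * ((k ^ t : Aˣ) : A))) - ((k⁻¹ : Aˣ) : A)) *
        ((k ^ (-t) : Aˣ) : A)) = f := by
  have h0 := hq.ne_zero
  have h1 := hq.sub_inv_ne_zero
  have hc : q ^ t * (q - q⁻¹)⁻¹ * θ⁻¹ * (q ^ (-t) * (q - q⁻¹) * θ) = 1 := by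
    rw [zpow_neg]
    have := zpow_ne_zero t h0
    rw [show q ^ t * (q - q⁻¹)⁻¹ * θ⁻¹ * ((q ^ t)⁻¹ * (q - q⁻¹) * θ) =
      (q ^ t * (q ^ t)⁻¹) * ((q - q⁻¹)⁻¹ * (q - q⁻¹)) * (θ * θ⁻¹) by ring,
      mul_inv_cancel₀ this, inv_mul_cancel₀ h1, mul_inv_cancel₀ hθ, one_mul, one_mul]
  rw [add_sub_cancel_left, smul_mul_assoc, smul_smul, hc, one_smul, mul_assoc, ← Units.val_mul,
    ← zpow_add]
  simp

theorem equitable_x_of_chevalley {q : F} (hq : IsGeneric q) {θ : F} (hθ : θ ≠ 0) (t : ℤ)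
    (x : A) (y : Aˣ) :
    ((y⁻¹ : Aˣ) : A) - (q ^ (1 + t) * (q - q⁻¹) * θ⁻¹) • (((y ^ (-1 - t) : Aˣ) : A) *
      ((q ^ (-1 - t) * (q - q⁻¹)⁻¹ * θ) • (((y ^ t : Aˣ) : A) * (1 - (y : A) * x)))) = x := by
  have h0 := hq.ne_zero
  have h1 := hq.sub_inv_ne_zero
  have hc : q ^ (1 + t) * (q - q⁻¹) * θ⁻¹ * (q ^ (-1 - t) * (q - q⁻¹)⁻¹ * θ) = 1 := by
    rw [show -1 - t = -(1 + t) by ring, zpow_neg]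
    have := zpow_ne_zero (1 + t) h0
    rw [show q ^ (1 + t) * (q - q⁻¹) * θ⁻¹ * ((q ^ (1 + t))⁻¹ * (q - q⁻¹)⁻¹ * θ) =
      ((q ^ (1 + t))⁻¹ * q ^ (1 + t)) * ((q - q⁻¹)⁻¹ * (q - q⁻¹)) * (θ * θ⁻¹) by ring,
      inv_mul_cancel₀ this, inv_mul_cancel₀ h1, mul_inv_cancel₀ hθ, one_mul, one_mul]
  have hy : ((y ^ (-1 - t) : Aˣ) : A) * ((y ^ t : Aˣ) : A) = ((y⁻¹ : Aˣ) : A) := by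
    rw [← Units.val_mul, ← zpow_add]; simp
  rw [mul_smul_comm, smul_smul, hc, one_smul, ← mul_assoc, hy, mul_sub, mul_one,
    Units.inv_mul_cancel_left, sub_sub_cancel]

theorem equitable_z_of_chevalley {q : F} (hq : IsGeneric q) {θ : F} (hθ : θ ≠ 0) (t : ℤ)
    (z : A) (y : Aˣ) :
    ((y⁻¹ : Aˣ) : A) + (q ^ (-t) * (q - q⁻¹) * θ) • (((q ^ t * (q - q⁻¹)⁻¹ * θ⁻¹) •
      ((z - ((y⁻¹ : Aˣ) : A)) * ((y ^ (-t) : Aˣ) : A))) * ((y ^ t : Aˣ) : A)) = z := by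
  have h0 := hq.ne_zero
  have h1 := hq.sub_inv_ne_zero
  have hc : q ^ (-t) * (q - q⁻¹) * θ * (q ^ t * (q - q⁻¹)⁻¹ * θ⁻¹) = 1 := by
    rw [zpow_neg]
    have := zpow_ne_zero t h0
    rw [show (q ^ t)⁻¹ * (q - q⁻¹) * θ * (q ^ t * (q - q⁻¹)⁻¹ * θ⁻¹) =
      (q ^ t * (q ^ t)⁻¹) * ((q - q⁻¹)⁻¹ * (q - q⁻¹)) * (θ * θ⁻¹) by ring,
      mul_inv_cancel₀ this, inv_mul_cancel₀ h1, mul_inv_cancel₀ hθ, one_mul, one_mul]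
  rw [smul_mul_assoc, smul_smul, hc, one_smul, mul_assoc, ← Units.val_mul, ← zpow_add]
  simp

end Inverses

section Presentations

/-- Names of the Chevalley generators `e`, `f`, `k`, `k⁻¹`. -/
inductive ChevalleyGen : Type
  | e
  | f
  | k
  | kinv

/-- Names of the equitable generators `x`, `y`, `y⁻¹`, `z`. -/
inductive EquitableGen : Type
  | x
  | y
  | yinv
  | z

variable (F : Type*) [Field F]

open FreeAlgebra in
/-- The relations of the Chevalley presentation, in the free algebra. -/
inductive ChevalleyStep (q : F) : FreeAlgebra F ChevalleyGen → FreeAlgebra F ChevalleyGen → Prop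
  | k_kinv : ChevalleyStep q (ι F ChevalleyGen.k * ι F ChevalleyGen.kinv) 1
  | kinv_k : ChevalleyStep q (ι F ChevalleyGen.kinv * ι F ChevalleyGen.k) 1
  | k_e : ChevalleyStep q (ι F ChevalleyGen.k * ι F ChevalleyGen.e)
      (q ^ 2 • (ι F ChevalleyGen.e * ι F ChevalleyGen.k))
  | k_f : ChevalleyStep q (ι F ChevalleyGen.k * ι F ChevalleyGen.f)
      ((q⁻¹) ^ 2 • (ι F ChevalleyGen.f * ι F ChevalleyGen.k))
  | e_f : ChevalleyStep q
      (ι F ChevalleyGen.e * ι F ChevalleyGen.f - ι F ChevalleyGen.f * ι F ChevalleyGen.e)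
      ((q - q⁻¹)⁻¹ • (ι F ChevalleyGen.k - ι F ChevalleyGen.kinv))

open FreeAlgebra in
/-- The relations of the equitable presentation, in the free algebra. -/
inductive EquitableStep (q : F) : FreeAlgebra F EquitableGen → FreeAlgebra F EquitableGen → Prop
  | y_yinv : EquitableStep q (ι F EquitableGen.y * ι F EquitableGen.yinv) 1
  | yinv_y : EquitableStep q (ι F EquitableGen.yinv * ι F EquitableGen.y) 1
  | x_y : EquitableStep q ((q - q⁻¹)⁻¹ • (q • (ι F EquitableGen.x * ι F EquitableGen.y) -
      q⁻¹ • (ι F EquitableGen.y * ι F EquitableGen.x))) 1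
  | y_z : EquitableStep q ((q - q⁻¹)⁻¹ • (q • (ι F EquitableGen.y * ι F EquitableGen.z) -
      q⁻¹ • (ι F EquitableGen.z * ι F EquitableGen.y))) 1
  | z_x : EquitableStep q ((q - q⁻¹)⁻¹ • (q • (ι F EquitableGen.z * ι F EquitableGen.x) -
      q⁻¹ • (ι F EquitableGen.x * ι F EquitableGen.z))) 1

/-- The quantum algebra `U_q(sl₂)` over `F`, in the Chevalley presentation. -/
def Uq (q : F) : Type _ := RingQuot (ChevalleyStep F q)

/-- The algebra given by the equitable presentation. -/
def Equitable (q : F) : Type _ := RingQuot (EquitableStep F q)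

noncomputable instance (q : F) : Ring (Uq F q) := inferInstanceAs (Ring (RingQuot _))
noncomputable instance (q : F) : Algebra F (Uq F q) := inferInstanceAs (Algebra F (RingQuot _))
noncomputable instance (q : F) : Ring (Equitable F q) := inferInstanceAs (Ring (RingQuot _))
noncomputable instance (q : F) : Algebra F (Equitable F q) :=
  inferInstanceAs (Algebra F (RingQuot _))

variable {F} (q : F)

namespace Uq

/-- The quotient map from the free algebra. -/
noncomputable def mk : FreeAlgebra F ChevalleyGen →ₐ[F] Uq F q :=
  RingQuot.mkAlgHom F (ChevalleyStep F q)

theorem mk_rel {a b : FreeAlgebra F ChevalleyGen} (h : ChevalleyStep F q a b) :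
    mk q a = mk q b :=
  RingQuot.mkAlgHom_rel F h

/-- The generator `e`. -/
noncomputable def e : Uq F q := mk q (FreeAlgebra.ι F ChevalleyGen.e)

/-- The generator `f`. -/
noncomputable def f : Uq F q := mk q (FreeAlgebra.ι F ChevalleyGen.f)

/-- The generator `k`, as a unit whose inverse is the generator `k⁻¹`. -/
noncomputable def k : (Uq F q)ˣ where
  val := mk q (FreeAlgebra.ι F ChevalleyGen.k)
  inv := mk q (FreeAlgebra.ι F ChevalleyGen.kinv)
  val_inv := by rw [← map_mul, mk_rel q ChevalleyStep.k_kinv, map_one]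
  inv_val := by rw [← map_mul, mk_rel q ChevalleyStep.kinv_k, map_one]

theorem rel : ChevalleyRel q (e q) (f q) (k q) where
  ke := by
    have h := mk_rel q ChevalleyStep.k_e
    simp only [map_mul, map_smul] at h
    exact h
  kf := by
    have h := mk_rel q ChevalleyStep.k_f
    simp only [map_mul, map_smul] at h
    exact h
  ef := by
    have h := mk_rel q ChevalleyStep.e_f
    simp only [map_mul, map_smul, map_sub] at h
    exact h

variable {q} {A : Type*} [Ring A] [Algebra F A]

/-- The algebra homomorphism from `U_q(sl₂)` given by elements that satisfy the relations. -/
noncomputable def lift {e' f' : A} {k' : Aˣ} (h : ChevalleyRel q e' f' k') : Uq F q →ₐ[F] A :=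
  RingQuot.liftAlgHom F ⟨FreeAlgebra.lift F fun g => match g with
    | ChevalleyGen.e => e'
    | ChevalleyGen.f => f'
    | ChevalleyGen.k => (k' : A)
    | ChevalleyGen.kinv => ((k'⁻¹ : Aˣ) : A), by
      rintro a b (_ | _ | _ | _ | _)
      · simp
      · simp
      · simpa using h.ke
      · simpa using h.kf
      · simpa using h.ef⟩

section

variable {e' f' : A} {k' : Aˣ} (h : ChevalleyRel q e' f' k')

theorem lift_e : lift h (e q) = e' := by
  exact (RingQuot.liftAlgHom_mkAlgHom_apply F _ _ _).trans (FreeAlgebra.lift_ι_apply _ _)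

theorem lift_f : lift h (f q) = f' := by
  exact (RingQuot.liftAlgHom_mkAlgHom_apply F _ _ _).trans (FreeAlgebra.lift_ι_apply _ _)

theorem lift_k : lift h (k q) = k' := by
  exact (RingQuot.liftAlgHom_mkAlgHom_apply F _ _ _).trans (FreeAlgebra.lift_ι_apply _ _)

theorem map_lift_k : Units.map (lift h : Uq F q →* A) (k q) = k' :=
  Units.ext (lift_k h)

end

theorem hom_ext {φ ψ : Uq F q →ₐ[F] A} (he : φ (e q) = ψ (e q)) (hf : φ (f q) = ψ (f q))
    (hk : φ (k q) = ψ (k q)) : φ = ψ := by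
  have hk' : φ ((k q)⁻¹ : (Uq F q)ˣ) = ψ ((k q)⁻¹ : (Uq F q)ˣ) := by
    have h : Units.map (φ : Uq F q →* A) (k q) = Units.map (ψ : Uq F q →* A) (k q) :=
      Units.ext hk
    have := congrArg (fun u : Aˣ => ((u⁻¹ : Aˣ) : A)) h
    simp only [← map_inv] at this
    exact this
  refine RingQuot.ringQuot_ext' F _ _ (FreeAlgebra.hom_ext (funext fun g => ?_))
  cases g
  · exact he
  · exact hf
  · exact hk
  · exact hk'

end Uq

namespace Equitable

/-- The quotient map from the free algebra. -/
noncomputable def mk : FreeAlgebra F EquitableGen →ₐ[F] Equitable F q :=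
  RingQuot.mkAlgHom F (EquitableStep F q)

theorem mk_rel {a b : FreeAlgebra F EquitableGen} (h : EquitableStep F q a b) :
    mk q a = mk q b :=
  RingQuot.mkAlgHom_rel F h

/-- The generator `x`. -/
noncomputable def x : Equitable F q := mk q (FreeAlgebra.ι F EquitableGen.x)

/-- The generator `y`, as a unit whose inverse is the generator `y⁻¹`. -/
noncomputable def y : (Equitable F q)ˣ where
  val := mk q (FreeAlgebra.ι F EquitableGen.y)
  inv := mk q (FreeAlgebra.ι F EquitableGen.yinv)
  val_inv := by rw [← map_mul, mk_rel q EquitableStep.y_yinv, map_one]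
  inv_val := by rw [← map_mul, mk_rel q EquitableStep.yinv_y, map_one]

/-- The generator `z`. -/
noncomputable def z : Equitable F q := mk q (FreeAlgebra.ι F EquitableGen.z)

theorem rel : EquitableRel q (x q) (y q) (z q) where
  xy := by
    have h := mk_rel q EquitableStep.x_y
    simp only [map_mul, map_smul, map_sub, map_one] at h
    exact h
  yz := by
    have h := mk_rel q EquitableStep.y_z
    simp only [map_mul, map_smul, map_sub, map_one] at h
    exact h
  zx := by
    have h := mk_rel q EquitableStep.z_x
    simp only [map_mul, map_smul, map_sub, map_one] at h
    exact h

/-- The element `n_x = q (1 - y z) / (q - q⁻¹)`. -/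
noncomputable def nX : Equitable F q := (q - q⁻¹)⁻¹ • (q • (1 - (y q : Equitable F q) * z q))

/-- The element `n_z = q (1 - x y) / (q - q⁻¹)`. -/
noncomputable def nZ : Equitable F q := (q - q⁻¹)⁻¹ • (q • (1 - x q * (y q : Equitable F q)))

variable {q} {A : Type*} [Ring A] [Algebra F A]

/-- The algebra homomorphism from the equitable algebra given by elements that satisfy the
relations. -/
noncomputable def lift {x' z' : A} {y' : Aˣ} (h : EquitableRel q x' y' z') :
    Equitable F q →ₐ[F] A :=
  RingQuot.liftAlgHom F ⟨FreeAlgebra.lift F fun g => match g with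
    | EquitableGen.x => x'
    | EquitableGen.y => (y' : A)
    | EquitableGen.yinv => ((y'⁻¹ : Aˣ) : A)
    | EquitableGen.z => z', by
      rintro a b (_ | _ | _ | _ | _)
      · simp
      · simp
      · simpa using h.xy
      · simpa using h.yz
      · simpa using h.zx⟩

section

variable {x' z' : A} {y' : Aˣ} (h : EquitableRel q x' y' z')

theorem lift_x : lift h (x q) = x' := by
  exact (RingQuot.liftAlgHom_mkAlgHom_apply F _ _ _).trans (FreeAlgebra.lift_ι_apply _ _)

theorem lift_y : lift h (y q) = y' := by
  exact (RingQuot.liftAlgHom_mkAlgHom_apply F _ _ _).trans (FreeAlgebra.lift_ι_apply _ _)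

theorem lift_z : lift h (z q) = z' := by
  exact (RingQuot.liftAlgHom_mkAlgHom_apply F _ _ _).trans (FreeAlgebra.lift_ι_apply _ _)

theorem map_lift_y : Units.map (lift h : Equitable F q →* A) (y q) = y' :=
  Units.ext (lift_y h)

end

theorem hom_ext {φ ψ : Equitable F q →ₐ[F] A} (hx : φ (x q) = ψ (x q))
    (hy : φ (y q) = ψ (y q)) (hz : φ (z q) = ψ (z q)) : φ = ψ := by
  have hy' : φ ((y q)⁻¹ : (Equitable F q)ˣ) = ψ ((y q)⁻¹ : (Equitable F q)ˣ) := by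
    have h : Units.map (φ : Equitable F q →* A) (y q) = Units.map (ψ : Equitable F q →* A) (y q) :=
      Units.ext hy
    have := congrArg (fun u : Aˣ => ((u⁻¹ : Aˣ) : A)) h
    simp only [← map_inv] at this
    exact this
  refine RingQuot.ringQuot_ext' F _ _ (FreeAlgebra.hom_ext (funext fun g => ?_))
  cases g
  · exact hx
  · exact hy
  · exact hy'
  · exact hz

end Equitable

theorem map_units_zpow {A B : Type*} [Ring A] [Algebra F A] [Ring B] [Algebra F B]
    (φ : A →ₐ[F] B) {u : Aˣ} {v : Bˣ} (h : φ u = v) (n : ℤ) :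
    φ ((u ^ n : Aˣ) : A) = ((v ^ n : Bˣ) : B) := by
  have h' : Units.map (φ : A →* B) u = v := Units.ext h
  rw [← h', ← map_zpow]
  rfl

theorem map_units_inv {A B : Type*} [Ring A] [Algebra F A] [Ring B] [Algebra F B]
    (φ : A →ₐ[F] B) {u : Aˣ} {v : Bˣ} (h : φ u = v) :
    φ ((u⁻¹ : Aˣ) : A) = ((v⁻¹ : Bˣ) : B) := by
  have h' := map_units_zpow φ h (-1)
  rwa [zpow_neg_one, zpow_neg_one] at h'

end Presentations

section Identifications

variable {F : Type*} [Field F] {q θ : F}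

/-- The primary identification of type `(θ, t)`: the isomorphism from the equitable algebra to
`U_q(sl₂)` that sends `x` to `k⁻¹ - k^(-1-t) e q^(1+t) (q - q⁻¹) θ⁻¹`, `y` to `k` and `z` to
`k⁻¹ + f k^t q^(-t) (q - q⁻¹) θ`. -/
noncomputable def primaryIdent (hq : IsGeneric q) (hθ : θ ≠ 0) (t : ℤ) :
    Equitable F q ≃ₐ[F] Uq F q :=
  AlgEquiv.ofAlgHom
    (Equitable.lift
      (x' := (((Uq.k q)⁻¹ : (Uq F q)ˣ) : Uq F q) -
        (q ^ (1 + t) * (q - q⁻¹) * θ⁻¹) • (((Uq.k q ^ (-1 - t) : (Uq F q)ˣ) : Uq F q) * Uq.e q))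
      (y' := Uq.k q)
      (z' := (((Uq.k q)⁻¹ : (Uq F q)ˣ) : Uq F q) +
        (q ^ (-t) * (q - q⁻¹) * θ) • (Uq.f q * ((Uq.k q ^ t : (Uq F q)ˣ) : Uq F q)))
      ((Uq.rel q).equitable hq hθ t))
    (Uq.lift ((Equitable.rel q).chevalley hq hθ t))
    (by
      apply Uq.hom_ext
      · simp only [AlgHom.comp_apply, AlgHom.id_apply, Uq.lift_e, map_smul, map_mul, map_sub,
          map_one, map_units_zpow _ (Equitable.lift_y _), Equitable.lift_y, Equitable.lift_x]
        exact chevalley_e_of_equitable hq hθ t _ _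
      · simp only [AlgHom.comp_apply, AlgHom.id_apply, Uq.lift_f, map_smul, map_mul, map_sub,
          map_units_zpow _ (Equitable.lift_y _), map_units_inv _ (Equitable.lift_y _),
          Equitable.lift_z]
        exact chevalley_f_of_equitable hq hθ t _ _
      · simp only [AlgHom.comp_apply, AlgHom.id_apply, Uq.lift_k, Equitable.lift_y])
    (by
      apply Equitable.hom_ext
      · simp only [AlgHom.comp_apply, AlgHom.id_apply, Equitable.lift_x, map_smul, map_mul,
          map_sub, map_units_zpow _ (Uq.lift_k _), map_units_inv _ (Uq.lift_k _), Uq.lift_e]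
        exact equitable_x_of_chevalley hq hθ t _ _
      · simp only [AlgHom.comp_apply, AlgHom.id_apply, Uq.lift_k, Equitable.lift_y]
      · simp only [AlgHom.comp_apply, AlgHom.id_apply, Equitable.lift_z, map_smul, map_mul,
          map_add, map_units_zpow _ (Uq.lift_k _), map_units_inv _ (Uq.lift_k _), Uq.lift_f]
        exact equitable_z_of_chevalley hq hθ t _ _)

/-- The secondary identification of type `(θ, t)`: the isomorphism from the equitable algebra to
`U_q(sl₂)` that sends `x` to `k - k^(1+t) f q^(1+t) (q - q⁻¹) θ⁻¹`, `y` to `k⁻¹` and `z` to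
`k + e k^(-t) q^(-t) (q - q⁻¹) θ`. -/
noncomputable def secondaryIdent (hq : IsGeneric q) (hθ : θ ≠ 0) (t : ℤ) :
    Equitable F q ≃ₐ[F] Uq F q :=
  AlgEquiv.ofAlgHom
    (Equitable.lift
      (x' := (Uq.k q : Uq F q) -
        (q ^ (1 + t) * (q - q⁻¹) * θ⁻¹) • (((Uq.k q ^ (1 + t) : (Uq F q)ˣ) : Uq F q) * Uq.f q))
      (y' := (Uq.k q)⁻¹)
      (z' := (Uq.k q : Uq F q) +
        (q ^ (-t) * (q - q⁻¹) * θ) • (Uq.e q * ((Uq.k q ^ (-t) : (Uq F q)ˣ) : Uq F q)))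
      (by
        have h := ((Uq.rel q).swap hq.ne_zero).equitable hq hθ t
        rwa [inv_inv, inv_zpow', inv_zpow', show -(-1 - t) = 1 + t by ring] at h))
    (Uq.lift (((Equitable.rel q).chevalley hq hθ t).swap hq.ne_zero))
    (by
      apply Uq.hom_ext
      · simp only [AlgHom.comp_apply, AlgHom.id_apply, Uq.lift_e, map_smul, map_mul, map_sub,
          map_units_zpow _ (Equitable.lift_y _), map_units_inv _ (Equitable.lift_y _),
          Equitable.lift_z]
        have h := chevalley_f_of_equitable hq hθ t (Uq.e q) (Uq.k q)⁻¹
        rw [inv_inv, inv_zpow' _ t] at h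
        exact h
      · simp only [AlgHom.comp_apply, AlgHom.id_apply, Uq.lift_f, map_smul, map_mul, map_sub,
          map_one, map_units_zpow _ (Equitable.lift_y _), Equitable.lift_y, Equitable.lift_x]
        have h := chevalley_e_of_equitable hq hθ t (Uq.f q) (Uq.k q)⁻¹
        rw [inv_inv, inv_zpow' _ (-1 - t), show -(-1 - t) = 1 + t by ring] at h
        exact h
      · simp only [AlgHom.comp_apply, AlgHom.id_apply, Uq.lift_k]
        rw [map_units_inv _ (Equitable.lift_y _), inv_inv])
    (by
      apply Equitable.hom_ext
      · simp only [AlgHom.comp_apply, AlgHom.id_apply, Equitable.lift_x, map_smul, map_mul,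
          map_sub, map_units_zpow _ (Uq.lift_k _), Uq.lift_k, Uq.lift_f]
        rw [inv_zpow', show -(1 + t) = -1 - t by ring]
        exact equitable_x_of_chevalley hq hθ t _ _
      · simp only [AlgHom.comp_apply, AlgHom.id_apply, Equitable.lift_y]
        rw [map_units_inv _ (Uq.lift_k _), inv_inv]
      · simp only [AlgHom.comp_apply, AlgHom.id_apply, Equitable.lift_z, map_smul, map_mul,
          map_add, map_units_zpow _ (Uq.lift_k _), Uq.lift_k, Uq.lift_e]
        rw [inv_zpow', neg_neg]
        exact equitable_z_of_chevalley hq hθ t _ _)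

end Identifications

section Modules

variable {F : Type*} [Field F] (q : F)
variable (V : Type*) [AddCommGroup V] [Module F V] [Module (Uq F q) V]

/-- The module `V` is isomorphic to `V_{d,ε}`: it has a basis `v_0, ..., v_d` with
`k v_i = ε q^{d-2i} v_i`, `f v_i = [i+1] v_{i+1}`, `f v_d = 0`, `e v_i = ε [d-i+1] v_{i-1}`,
`e v_0 = 0`. -/
def IsVd (d : ℕ) (ε : F) : Prop :=
  ∃ v : Module.Basis (Fin (d + 1)) F V,
    (∀ i : Fin (d + 1), (Uq.k q : Uq F q) • v i = (ε * q ^ ((d : ℤ) - 2 * (i : ℤ))) • v i) ∧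
    (∀ i : Fin d, Uq.f q • v i.castSucc = qInt q ((i : ℤ) + 1) • v i.succ) ∧
    Uq.f q • v (Fin.last d) = 0 ∧
    (∀ i : Fin d, Uq.e q • v i.succ = (ε * qInt q ((d : ℤ) - (i : ℤ))) • v i.castSucc) ∧
    Uq.e q • v 0 = 0

variable [IsScalarTower F (Uq F q) V]

/-- The action of `U_q(sl₂)` on a module. -/
noncomputable def act : Uq F q →ₐ[F] Module.End F V := Algebra.lsmul F F V

/-- The module `V` has type 1: it is nonzero and a direct sum of irreducible submodules, each of
which has type 1. -/
def IsTypeOne : Prop :=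
  Nontrivial V ∧ ∃ (n : ℕ) (W : Fin n → Submodule (Uq F q) V), DirectSum.IsInternal W ∧
    ∀ i, IsSimpleModule (Uq F q) (W i) ∧ ∃ d : ℕ, IsVd q (W i) d 1

/-- The weight space `V(l)`, that is, the vectors `v` with `k v = q^l v`. -/
noncomputable def weightSpace (l : ℤ) : Submodule F V :=
  Module.End.eigenspace (act q V (Uq.k q)) (q ^ l)

variable {q V}

theorem mem_weightSpace {l : ℤ} {v : V} :
    v ∈ weightSpace q V l ↔ (Uq.k q : Uq F q) • v = q ^ l • v :=
  Module.End.mem_eigenspace_iff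

/-- A module of type 1 is the direct sum of its weight spaces. -/
theorem weightSpace_isInternal (hq : IsGeneric q) (hV : IsTypeOne q V) :
    DirectSum.IsInternal (weightSpace q V) := by
  apply DirectSum.isInternal_submodule_of_iSupIndep_of_iSup_eq_top
  · exact (Module.End.eigenspaces_iSupIndep (act q V (Uq.k q))).comp hq.zpow_injective
  · obtain ⟨-, n, W, hW, hi⟩ := hV
    rw [eq_top_iff]
    intro v _
    have hv : v ∈ ⨆ i, W i := by rw [hW.submodule_iSup_eq_top]; trivial
    induction hv using Submodule.iSup_induction' with
    | zero => exact zero_mem _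
    | add x y _ _ hx hy => exact add_mem (hx trivial) (hy trivial)
    | mem i w hw =>
      obtain ⟨-, d, b, hb, -⟩ := hi i
      have hsum := congrArg (Submodule.subtype (W i)) (b.sum_repr ⟨w, hw⟩)
      rw [map_sum] at hsum
      rw [show w = (W i).subtype ⟨w, hw⟩ from rfl, ← hsum]
      refine sum_mem fun j _ => ?_
      refine (Submodule.smul_mem _ _ (Submodule.mem_iSup_of_mem ((d : ℤ) - 2 * (j : ℤ)) ?_) :
        b.repr ⟨w, hw⟩ j • (b j : V) ∈ ⨆ l, weightSpace q V l)
      rw [mem_weightSpace]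
      have := congrArg (Submodule.subtype (W i)) (hb j)
      rw [one_mul] at this
      exact this

/-- The linear operator on a module of type 1 that acts on each weight space `V(l)` as `A l`. -/
noncomputable def weightwise (hq : IsGeneric q) (hV : IsTypeOne q V)
    (A : ℤ → Module.End F V) : Module.End F V :=
  (DirectSum.toModule F ℤ V fun l => A l ∘ₗ (weightSpace q V l).subtype) ∘ₗ
    (LinearEquiv.ofBijective (DirectSum.coeLinearMap (weightSpace q V))
      (weightSpace_isInternal hq hV)).symm.toLinearMap

theorem weightwise_apply (hq : IsGeneric q) (hV : IsTypeOne q V) (A : ℤ → Module.End F V)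
    {l : ℤ} {v : V} (hv : v ∈ weightSpace q V l) : weightwise hq hV A v = A l v := by
  have h : (LinearEquiv.ofBijective (DirectSum.coeLinearMap (weightSpace q V))
      (weightSpace_isInternal hq hV)).symm v =
      DirectSum.lof F ℤ (fun l => weightSpace q V l) l ⟨v, hv⟩ := by
    rw [LinearEquiv.symm_apply_eq]
    exact (DirectSum.coeLinearMap_lof (weightSpace q V) l ⟨v, hv⟩).symm
  simp only [weightwise, LinearMap.comp_apply, LinearEquiv.coe_coe, h, DirectSum.toModule_lof,
    Submodule.subtype_apply]

section Operators

/-- The `q`-exponential `exp_q(φ) = ∑ i, q^(i choose 2) φ^i / [i]_q!` of a nilpotent operator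
(only finitely many terms are nonzero). -/
noncomputable def expq {V : Type*} [AddCommGroup V] [Module F V] (q : F)
    (φ : Module.End F V) : Module.End F V :=
  ∑ᶠ i : ℕ, (q ^ i.choose 2 / qFact q i) • φ ^ i

variable (q V)

/-- The sum of `e^a f^b e^c (-1)^b q^(b-ac) / ([a]! [b]! [c]!)` over all natural numbers `a`,
`b`, `c` with `b - a - c = l` (only finitely many terms are nonzero, as `e` is nilpotent). -/
noncomputable def lusztigSum (l : ℤ) : Module.End F V :=
  ∑ᶠ p ∈ {p : ℕ × ℕ × ℕ | (p.2.1 : ℤ) - (p.1 : ℤ) - (p.2.2 : ℤ) = l},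
    ((-1) ^ p.2.1 * q ^ ((p.2.1 : ℤ) - (p.1 : ℤ) * (p.2.2 : ℤ)) /
      (qFact q p.1 * qFact q p.2.1 * qFact q p.2.2)) •
    (act q V (Uq.e q) ^ p.1 * act q V (Uq.f q) ^ p.2.1 * act q V (Uq.e q) ^ p.2.2)

/-- The sum of `f^a e^b f^c (-1)^b q^(b-ac) / ([a]! [b]! [c]!)` over all natural numbers `a`,
`b`, `c` with `a - b + c = l` (only finitely many terms are nonzero, as `f` is nilpotent). -/
noncomputable def lusztigSumCheck (l : ℤ) : Module.End F V :=
  ∑ᶠ p ∈ {p : ℕ × ℕ × ℕ | (p.1 : ℤ) - (p.2.1 : ℤ) + (p.2.2 : ℤ) = l},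
    ((-1) ^ p.2.1 * q ^ ((p.2.1 : ℤ) - (p.1 : ℤ) * (p.2.2 : ℤ)) /
      (qFact q p.1 * qFact q p.2.1 * qFact q p.2.2)) •
    (act q V (Uq.f q) ^ p.1 * act q V (Uq.e q) ^ p.2.1 * act q V (Uq.f q) ^ p.2.2)

variable {q V}

/-- The Lusztig operator `T` on a module of type 1. -/
noncomputable def lusztigT (hq : IsGeneric q) (hV : IsTypeOne q V) : Module.End F V :=
  weightwise hq hV (lusztigSum q V)

/-- The second Lusztig operator `T^∨` on a module of type 1. -/
noncomputable def lusztigTCheck (hq : IsGeneric q) (hV : IsTypeOne q V) : Module.End F V :=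
  weightwise hq hV (lusztigSumCheck q V)

open Classical in
/-- The square root `q^(1/2)` attached to `θ`: it is `-θ` if `θ^2 = q`, and `θ⁻¹` if
`θ^2 = q⁻¹`. -/
noncomputable def sqrtq (q θ : F) : F := if θ ^ 2 = q then -θ else θ⁻¹

/-- The operator `Υ`, which acts on `V(l)` as the scalar `q^(-l^2/2)`. -/
noncomputable def upsilon (hq : IsGeneric q) (θ : F) (hV : IsTypeOne q V) : Module.End F V :=
  weightwise hq hV fun l => (sqrtq q θ ^ (-(l ^ 2))) • (1 : Module.End F V)

/-- The operator `exp_q(n_x) Υ exp_q(n_z)`, for an identification `φ` of the equitable algebra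
with `U_q(sl₂)`. -/
noncomputable def rotator (hq : IsGeneric q) (θ : F) (hV : IsTypeOne q V)
    (φ : Equitable F q ≃ₐ[F] Uq F q) : Module.End F V :=
  expq q (act q V (φ (Equitable.nX q))) * upsilon hq θ hV *
    expq q (act q V (φ (Equitable.nZ q)))

end Operators

end Modules

end QSl2

/-!
The module is spanned by strings: families `v 0, …, v d` on which `e`, `f` and `k` act as on the
standard basis of an irreducible module (`IsTypeOne.spannedByStrings`). So it is enough to evaluate
both sides of each equation on a string, where each of them maps `v j` to a multiple of `v (d - j)`.

For the Lusztig operator, the coefficient is a double sum of products of three Gaussian binomials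
over `a` and `c`, as `b` is determined by the weight. For fixed `c` the sum over `a` is an
alternating `q`-Vandermonde sum, which vanishes unless `c = 0`; this gives
`T (v j) = (-1) ^ (d - j) q ^ ((d - j) (j + 1)) v (d - j)` (`IsString.tripleSum_apply`).

For the exponentials, the vectors `u j = θ ^ j q ^ (t j (d - j)) v j` absorb `θ` and `t`: the
operator `n_z` lowers them as `e` does, and `n_x` raises their multiples by
`(-1) ^ j q ^ (j (d - j))` as `f` does. In the matrix entries of `exp_q(n_x) Υ exp_q(n_z)`, the
quadratic exponents of `q` in the summation index cancel, and another alternating `q`-Vandermonde sum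
(`sum_entries`) identifies the image of `u j` with a multiple of `exp_q(n_z)⁻¹ u (d - j)`, where
`exp_q(n_z)⁻¹ = exp_{q⁻¹}(-n_z)`. Applying `exp_q(n_z)` leaves a multiple of `u (d - j)`
(`rotator_apply`), and the scalars are inverse to those of the Lusztig operator.

Interchanging `e` with `f` and `k` with `k⁻¹` reverses strings, and it exchanges `T` with `T^∨` and
the primary with the secondary identification. So the four equations come from two computations,
`SpannedByStrings.inverse_eq` and `SpannedByStrings.inverse_eq_of_reverse`.
-/

namespace QSl2

/-! ### Gaussian binomial coefficients -/

section Binomials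

variable {F : Type*} [Field F] {q : F}

theorem qInt_zero (q : F) : qInt q 0 = 0 := by simp [qInt]

theorem IsGeneric.qInt_ne_zero (hq : IsGeneric q) {n : ℤ} (hn : n ≠ 0) : qInt q n ≠ 0 := by
  refine div_ne_zero (sub_ne_zero.2 fun h => hn ?_) hq.sub_inv_ne_zero
  have : n = -n := hq.zpow_injective h
  omega

theorem qFact_zero (q : F) : qFact q 0 = 1 := by simp [qFact]

theorem qFact_succ (q : F) (n : ℕ) : qFact q (n + 1) = qFact q n * qInt q (n + 1) := by
  rw [qFact, Finset.prod_range_succ, qFact]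

theorem IsGeneric.qFact_ne_zero (hq : IsGeneric q) (n : ℕ) : qFact q n ≠ 0 :=
  Finset.prod_ne_zero_iff.2 fun i _ => hq.qInt_ne_zero (by omega)

/-- The Gaussian binomial coefficient `[n][n-1]⋯[n-k+1] / [k]!`, symmetric under `q ↦ q⁻¹`. The
upper entry is any integer; the coefficient is zero when the lower entry is negative. -/
def qBinom (q : F) (n : ℤ) : ℤ → F
  | Int.ofNat k => (∏ l ∈ Finset.range k, qInt q (n - l)) / qFact q k
  | Int.negSucc _ => 0

theorem qBinom_natCast (q : F) (n : ℤ) (k : ℕ) :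
    qBinom q n k = (∏ l ∈ Finset.range k, qInt q (n - l)) / qFact q k := rfl

theorem qBinom_zero_right (q : F) (n : ℤ) : qBinom q n 0 = 1 := by
  have := qBinom_natCast q n 0
  simpa [qFact_zero] using this

theorem qBinom_of_neg (q : F) (n : ℤ) {k : ℤ} (hk : k < 0) : qBinom q n k = 0 := by
  obtain ⟨m, rfl⟩ := Int.eq_negSucc_of_lt_zero hk
  rfl

theorem qBinom_of_lt (q : F) {n k : ℤ} (hn : 0 ≤ n) (hk : n < k) : qBinom q n k = 0 := by
  lift k to ℕ using by omega
  lift n to ℕ using hn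
  rw [qBinom_natCast, Finset.prod_eq_zero (Finset.mem_range.2 (by omega : n < k)), zero_div]
  rw [sub_self, qInt_zero]

theorem qInt_mul_qBinom_succ (hq : IsGeneric q) (n : ℤ) (k : ℕ) :
    qInt q (k + 1) * qBinom q n (k + 1) = qInt q (n - k) * qBinom q n k := by
  have h1 := hq.qFact_ne_zero k
  have h2 : qInt q ((k : ℤ) + 1) ≠ 0 := hq.qInt_ne_zero (by omega)
  have := qBinom_natCast q n (k + 1)
  push_cast at this
  rw [this, qBinom_natCast, Finset.prod_range_succ, qFact_succ]
  field_simp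

theorem qInt_mul_qBinom_succ_succ (hq : IsGeneric q) (n : ℤ) (k : ℕ) :
    qInt q (k + 1) * qBinom q (n + 1) (k + 1) = qInt q (n + 1) * qBinom q n k := by
  have h1 := hq.qFact_ne_zero k
  have h2 : qInt q ((k : ℤ) + 1) ≠ 0 := hq.qInt_ne_zero (by omega)
  have := qBinom_natCast q (n + 1) (k + 1)
  push_cast at this
  rw [this, qBinom_natCast, Finset.prod_range_succ', qFact_succ]
  have : ∀ l : ℕ, n + 1 - ((l + 1 : ℕ) : ℤ) = n - l := fun l => by push_cast; ring
  simp only [this, Nat.cast_zero, sub_zero]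
  field_simp

theorem qBinom_mul_qFact (hq : IsGeneric q) (k l : ℕ) :
    qBinom q (k + l) k * (qFact q k * qFact q l) = qFact q (k + l) := by
  induction k with
  | zero => simp [qBinom_zero_right, qFact_zero]
  | succ k ih =>
    have h := qInt_mul_qBinom_succ_succ hq (k + l) k
    have e : ((k + 1 : ℕ) : ℤ) + l = k + l + 1 := by push_cast; ring
    rw [show k + 1 + l = k + l + 1 by ring, qFact_succ, qFact_succ, ← ih, e]
    push_cast
    linear_combination (qFact q k * qFact q l) * h

theorem qBinom_symm (hq : IsGeneric q) {n : ℤ} (hn : 0 ≤ n) (k : ℤ) :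
    qBinom q n k = qBinom q n (n - k) := by
  rcases lt_or_ge k 0 with hk | hk
  · rw [qBinom_of_neg q n hk, qBinom_of_lt q hn (by omega)]
  rcases lt_or_ge n k with hk' | hk'
  · rw [qBinom_of_lt q hn hk', qBinom_of_neg q n (by omega)]
  lift k to ℕ using hk
  obtain ⟨l, hl⟩ := Int.eq_ofNat_of_zero_le (show 0 ≤ n - k by omega)
  obtain rfl : n = k + l := by omega
  have h1 := qBinom_mul_qFact hq k l
  have h2 := qBinom_mul_qFact hq l k
  rw [add_comm l k, ← h1, add_comm (l : ℤ) k, mul_comm (qFact q l)] at h2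
  rw [hl]
  exact (mul_right_cancel₀ (mul_ne_zero (hq.qFact_ne_zero k) (hq.qFact_ne_zero l)) h2).symm

theorem qBinom_pascal (hq : IsGeneric q) (n k : ℤ) :
    qBinom q (n + 1) k = q ^ (-k) * qBinom q n k + q ^ (n + 1 - k) * qBinom q n (k - 1) := by
  rcases lt_trichotomy k 0 with hk | rfl | hk
  · rw [qBinom_of_neg _ _ hk, qBinom_of_neg _ _ hk, qBinom_of_neg _ _ (by omega : k - 1 < 0)]
    ring
  · rw [qBinom_of_neg _ _ (by omega : (0 : ℤ) - 1 < 0)]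
    simp [qBinom_zero_right]
  obtain ⟨k, rfl⟩ : ∃ m : ℕ, k = m + 1 := ⟨(k - 1).toNat, by omega⟩
  have h1 := qInt_mul_qBinom_succ hq n k
  have h2 := qInt_mul_qBinom_succ_succ hq n k
  have h3 : qInt q ((k : ℤ) + 1) ≠ 0 := hq.qInt_ne_zero (by omega)
  have h0 := hq.ne_zero
  have key : qInt q (n + 1)
      = q ^ (-((k : ℤ) + 1)) * qInt q (n - k) + q ^ (n - k) * qInt q (k + 1) := by
    simp only [qInt, mul_div_assoc', ← add_div, mul_sub, ← zpow_add₀ h0]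
    ring_nf
  apply mul_left_cancel₀ h3
  rw [h2, show n + 1 - ((k : ℤ) + 1) = n - k by ring, add_sub_cancel_right]
  linear_combination qBinom q n k * key - q ^ (-((k : ℤ) + 1)) * h1

theorem qBinom_pascal' (hq : IsGeneric q) (n k : ℤ) :
    qBinom q (n + 1) k = q ^ k * qBinom q n k + q ^ (-(n + 1 - k)) * qBinom q n (k - 1) := by
  rcases lt_trichotomy k 0 with hk | rfl | hk
  · rw [qBinom_of_neg _ _ hk, qBinom_of_neg _ _ hk, qBinom_of_neg _ _ (by omega : k - 1 < 0)]
    ring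
  · rw [qBinom_of_neg _ _ (by omega : (0 : ℤ) - 1 < 0)]
    simp [qBinom_zero_right]
  obtain ⟨k, rfl⟩ : ∃ m : ℕ, k = m + 1 := ⟨(k - 1).toNat, by omega⟩
  have h1 := qInt_mul_qBinom_succ hq n k
  have h2 := qInt_mul_qBinom_succ_succ hq n k
  have h3 : qInt q ((k : ℤ) + 1) ≠ 0 := hq.qInt_ne_zero (by omega)
  have h0 := hq.ne_zero
  have key : qInt q (n + 1)
      = q ^ ((k : ℤ) + 1) * qInt q (n - k) + q ^ (-(n - k)) * qInt q (k + 1) := by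
    simp only [qInt, mul_div_assoc', ← add_div, mul_sub, ← zpow_add₀ h0]
    ring_nf
  apply mul_left_cancel₀ h3
  rw [h2, show n + 1 - ((k : ℤ) + 1) = n - k by ring, add_sub_cancel_right]
  linear_combination qBinom q n k * key - q ^ ((k : ℤ) + 1) * h1

/-- Pascal's rule inside an alternating sum: it relates the sum with upper entry `L + 1` to two
sums with upper entry `L`. -/
theorem sum_qBinom_succ (hq : IsGeneric q) (L : ℕ) (s : ℤ) (g : ℕ → F) :
    ∑ a ∈ Finset.range (L + 2), (-1) ^ a * q ^ (a * s) * qBinom q ((L + 1 : ℕ) : ℤ) a * g a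
      = ∑ a ∈ Finset.range (L + 1), (-1) ^ a * q ^ (a * (s + 1)) * qBinom q L a * g a
        - q ^ (s - L) * ∑ a ∈ Finset.range (L + 1),
            (-1) ^ a * q ^ (a * (s + 1)) * qBinom q L a * g (a + 1) := by
  have h0 := hq.ne_zero
  have hsplit : ∀ a : ℕ, (-1) ^ a * q ^ (a * s) * qBinom q ((L + 1 : ℕ) : ℤ) a * g a
      = (-1) ^ a * q ^ (a * (s + 1)) * qBinom q L a * g a
        + (-1) ^ a * q ^ (a * (s + 1) - (L + 1)) * qBinom q L (a - 1) * g a := fun a => by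
    rw [Nat.cast_succ, qBinom_pascal' hq, mul_add (a : ℤ), mul_one,
      show a * s + a - ((L : ℤ) + 1) = a * s + -((L : ℤ) + 1 - a) by ring, zpow_add₀ h0,
      zpow_add₀ h0]
    ring
  simp only [hsplit]
  rw [Finset.sum_add_distrib, sub_eq_add_neg]
  congr 1
  · rw [Finset.sum_range_succ, qBinom_of_lt q (by omega) (by omega : (L : ℤ) < (L + 1 : ℕ))]
    ring
  · rw [Finset.sum_range_succ', qBinom_of_neg q _ (by simp), Finset.mul_sum,
      ← Finset.sum_neg_distrib, mul_zero, zero_mul, add_zero]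
    refine Finset.sum_congr rfl fun a _ => ?_
    rw [Nat.cast_succ, add_sub_cancel_right,
      show ((a : ℤ) + 1) * (s + 1) - (L + 1) = (s - L) + a * (s + 1) by ring, zpow_add₀ h0]
    ring

/-- An alternating form of the `q`-Vandermonde identity. The sum vanishes for `m < L`, which is what
kills most of the terms of Lusztig's triple sum. -/
theorem sum_qBinom_mul_qBinom_add (hq : IsGeneric q) (m : ℤ) (L : ℕ) (n : ℤ) :
    ∑ a ∈ Finset.range (L + 1),
        (-1) ^ a * q ^ (a * (m - L + 1)) * qBinom q L a * qBinom q (n + a) m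
      = (-1) ^ L * q ^ (L * (n + 1)) * qBinom q n (m - L) := by
  have h0 := hq.ne_zero
  induction L generalizing n with
  | zero => simp [qBinom_zero_right]
  | succ L ih =>
    rw [sum_qBinom_succ hq L (m - (L + 1 : ℕ) + 1) fun a => qBinom q (n + a) m]
    have e : m - ((L + 1 : ℕ) : ℤ) + 1 + 1 = m - L + 1 := by push_cast; ring
    have hs : ∀ a : ℕ, n + ((a + 1 : ℕ) : ℤ) = n + 1 + a := fun a => by push_cast; ring
    simp only [e, hs, ih]
    rw [qBinom_pascal hq]
    simp only [Nat.cast_succ]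
    rw [show m - ((L : ℤ) + 1) = m - L - 1 by ring,
      show ((L : ℤ) + 1) * (n + 1) = (m - L - 1 + 1 - L) + L * (n + 1 + 1) + (n + 1 - (m - L)) by
        ring, zpow_add₀ h0, zpow_add₀ h0,
      show (L : ℤ) * (n + 1) = (m - L - 1 + 1 - L) + L * (n + 1 + 1) + -(m - L) by ring,
      zpow_add₀ h0, zpow_add₀ h0, pow_succ]
    ring

/-- A second alternating form of the `q`-Vandermonde identity, with the summation variable
subtracted in the upper entry. -/
theorem sum_qBinom_mul_qBinom_sub (hq : IsGeneric q) (m : ℤ) (L : ℕ) (n : ℤ) :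
    ∑ a ∈ Finset.range (L + 1),
        (-1) ^ a * q ^ (a * (m - L + 1)) * qBinom q L a * qBinom q (n - a) m
      = q ^ (-(L * (n - m))) * qBinom q (n - L) (m - L) := by
  have h0 := hq.ne_zero
  induction L generalizing n with
  | zero => simp [qBinom_zero_right]
  | succ L ih =>
    rw [sum_qBinom_succ hq L (m - (L + 1 : ℕ) + 1) fun a => qBinom q (n - a) m]
    have e : m - ((L + 1 : ℕ) : ℤ) + 1 + 1 = m - L + 1 := by push_cast; ring
    have hs : ∀ a : ℕ, n - ((a + 1 : ℕ) : ℤ) = n - 1 - a := fun a => by push_cast; ring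
    simp only [e, hs, ih]
    simp only [Nat.cast_succ]
    rw [show n - (L : ℤ) = n - ((L : ℤ) + 1) + 1 by ring, qBinom_pascal' hq, mul_add (q ^ _),
      show m - ((L : ℤ) + 1) = m - L - 1 by ring,
      show -(((L : ℤ) + 1) * (n - m))
        = -(L * (n - m)) + -(n - ((L : ℤ) + 1) + 1 - (m - L)) by ring, zpow_add₀ h0,
      show -((L : ℤ) * (n - 1 - m)) = -(L * (n - m)) + L by ring, zpow_add₀ h0,
      show m - L - 1 + 1 - (L : ℤ) = (m - L) + -L by ring, zpow_add₀ h0 (m - L),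
      zpow_neg q (L : ℤ), show n - 1 - (L : ℤ) = n - (L + 1) by ring]
    have := zpow_ne_zero (L : ℤ) h0
    field_simp
    ring

end Binomials

/-! ### Strings of weight vectors -/

section Strings

variable {F : Type*} [Field F] {q : F} {V : Type*} [AddCommGroup V] [Module F V]

/-- A family of vectors `v i`, zero unless `0 ≤ i ≤ d`, on which `e`, `f` and `k` act as on the
standard basis of the irreducible module of dimension `d + 1` and type 1. Indexing by all integers
lets the two formulas for `e` and `f` hold without boundary cases. -/
structure IsString (q : F) (e f : Module.End F V) (k : (Module.End F V)ˣ) (d : ℕ) (v : ℤ → V) :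
    Prop where
  eq_zero : ∀ i, i < 0 ∨ (d : ℤ) < i → v i = 0
  k_apply : ∀ i, (k : Module.End F V) (v i) = q ^ ((d : ℤ) - 2 * i) • v i
  e_apply : ∀ i, e (v i) = qInt q (d - i + 1) • v (i - 1)
  f_apply : ∀ i, f (v i) = qInt q (i + 1) • v (i + 1)

variable {e f : Module.End F V} {k : (Module.End F V)ˣ} {d : ℕ} {v : ℤ → V}

theorem inv_apply_of_apply {c : F} (hc : c ≠ 0) {w : V} (h : (k : Module.End F V) w = c • w) :
    ((k⁻¹ : (Module.End F V)ˣ) : Module.End F V) w = c⁻¹ • w := by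
  have : w = ((k⁻¹ : (Module.End F V)ˣ) : Module.End F V) (c • w) := by
    rw [← h, ← Module.End.mul_apply, Units.inv_mul, Module.End.one_apply]
  rw [map_smul] at this
  rw [eq_inv_smul_iff₀ hc]
  exact this.symm

theorem zpow_apply_of_apply {c : F} (hc : c ≠ 0) {w : V} (h : (k : Module.End F V) w = c • w)
    (n : ℤ) : ((k ^ n : (Module.End F V)ˣ) : Module.End F V) w = c ^ n • w := by
  induction n using Int.induction_on with
  | zero => simp
  | succ n ih =>
    rw [zpow_add_one, Units.val_mul, Module.End.mul_apply, h, map_smul, ih, smul_smul,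
      zpow_add_one₀ hc, mul_comm]
  | pred n ih =>
    rw [zpow_sub_one, Units.val_mul, Module.End.mul_apply, inv_apply_of_apply hc h, map_smul, ih,
      smul_smul, zpow_sub_one₀ hc, mul_comm]

/-- Reversing a string interchanges the roles of `e` and `f`, and of `k` and its inverse. -/
theorem IsString.reverse (hq : IsGeneric q) (h : IsString q e f k d v) :
    IsString q f e k⁻¹ d fun i => v (d - i) where
  eq_zero i hi := h.eq_zero _ (by omega)
  k_apply i := by
    rw [inv_apply_of_apply (zpow_ne_zero _ hq.ne_zero) (h.k_apply _), ← zpow_neg]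
    congr 2
    ring
  e_apply i := by
    rw [h.f_apply]
    congr 2
    ring
  f_apply i := by
    rw [h.e_apply]
    congr 2 <;> ring

theorem IsString.k_zpow_apply (hq : IsGeneric q) (h : IsString q e f k d v) (n i : ℤ) :
    ((k ^ n : (Module.End F V)ˣ) : Module.End F V) (v i) = q ^ (n * (d - 2 * i)) • v i := by
  rw [zpow_apply_of_apply (zpow_ne_zero _ hq.ne_zero) (h.k_apply i), ← zpow_mul, mul_comm n]

/-- Powers of a lowering operator with coefficients `[d - i + 1]`. -/
theorem pow_apply_of_lower (hq : IsGeneric q) {φ : Module.End F V} {v : ℤ → V} {d : ℤ}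
    (h : ∀ i, φ (v i) = qInt q (d - i + 1) • v (i - 1)) (m : ℕ) (i : ℤ) :
    (φ ^ m) (v i) = (qFact q m * qBinom q (d - i + m) m) • v (i - m) := by
  induction m with
  | zero => simp [qFact_zero, qBinom_zero_right]
  | succ m ih =>
    have h1 := qInt_mul_qBinom_succ_succ hq (d - i + m) m
    rw [pow_succ', Module.End.mul_apply, ih, map_smul, h, smul_smul, qFact_succ, Nat.cast_succ,
      ← add_assoc, ← sub_sub i, mul_assoc (qFact q m) (qInt q _), h1,
      show d - (i - m) + 1 = d - i + m + 1 by ring]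
    congr 1
    ring

/-- Powers of a raising operator with coefficients `[i + 1]`. -/
theorem pow_apply_of_raise (hq : IsGeneric q) {φ : Module.End F V} {v : ℤ → V}
    (h : ∀ i, φ (v i) = qInt q (i + 1) • v (i + 1)) (m : ℕ) (i : ℤ) :
    (φ ^ m) (v i) = (qFact q m * qBinom q (i + m) m) • v (i + m) := by
  induction m with
  | zero => simp [qFact_zero, qBinom_zero_right]
  | succ m ih =>
    have h1 := qInt_mul_qBinom_succ_succ hq (i + m) m
    rw [pow_succ', Module.End.mul_apply, ih, map_smul, h, smul_smul, qFact_succ, Nat.cast_succ,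
      ← add_assoc, mul_assoc (qFact q m) (qInt q _), h1]
    congr 1
    ring

theorem IsString.e_pow_apply (hq : IsGeneric q) (h : IsString q e f k d v) (m : ℕ) (i : ℤ) :
    (e ^ m) (v i) = (qFact q m * qBinom q (d - i + m) m) • v (i - m) :=
  pow_apply_of_lower hq h.e_apply m i

theorem IsString.f_pow_apply (hq : IsGeneric q) (h : IsString q e f k d v) (m : ℕ) (i : ℤ) :
    (f ^ m) (v i) = (qFact q m * qBinom q (i + m) m) • v (i + m) :=
  pow_apply_of_raise hq h.f_apply m i

end Strings

/-! ### Lusztig's operator on a string -/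

section Lusztig

variable {F : Type*} [Field F] {q : F} {V : Type*} [AddCommGroup V] [Module F V]

/-- The sum of `e^a f^b e^c (-1)^b q^(b-ac) / ([a]! [b]! [c]!)` over all natural numbers `a`, `b`,
`c` with `b - a - c = l`, for arbitrary endomorphisms `e` and `f`. Both Lusztig operators are of
this form on a weight space. -/
noncomputable def tripleSum (q : F) (e f : Module.End F V) (l : ℤ) : Module.End F V :=
  ∑ᶠ p ∈ {p : ℕ × ℕ × ℕ | (p.2.1 : ℤ) - (p.1 : ℤ) - (p.2.2 : ℤ) = l},
    ((-1) ^ p.2.1 * q ^ ((p.2.1 : ℤ) - (p.1 : ℤ) * (p.2.2 : ℤ)) /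
      (qFact q p.1 * qFact q p.2.1 * qFact q p.2.2)) •
    (e ^ p.1 * f ^ p.2.1 * e ^ p.2.2)

variable {e f : Module.End F V} {k : (Module.End F V)ˣ} {d : ℕ} {v : ℤ → V}

/-- For nilpotent `e` and `f`, only finitely many terms of the triple sum are nonzero. -/
theorem tripleSum_apply (he : IsNilpotent e) (hf : IsNilpotent f) (l : ℤ) (w : V) :
    tripleSum q e f l w =
      ∑ᶠ p ∈ {p : ℕ × ℕ × ℕ | (p.2.1 : ℤ) - (p.1 : ℤ) - (p.2.2 : ℤ) = l},
        ((-1) ^ p.2.1 * q ^ ((p.2.1 : ℤ) - (p.1 : ℤ) * (p.2.2 : ℤ)) /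
          (qFact q p.1 * qFact q p.2.1 * qFact q p.2.2)) •
        (e ^ p.1) ((f ^ p.2.1) ((e ^ p.2.2) w)) := by
  obtain ⟨m, hm⟩ := he
  obtain ⟨n, hn⟩ := hf
  rw [tripleSum, ← LinearMap.applyₗ_apply_apply (R := F) w]
  refine AddMonoidHom.map_finsum_mem' (LinearMap.applyₗ (R := F) w).toAddMonoidHom ?_
  refine ((Finset.range m ×ˢ Finset.range n ×ˢ Finset.range m).finite_toSet).subset ?_
  rintro ⟨a, b, c⟩ ⟨-, hp⟩
  simp only [Finset.coe_product, Set.mem_prod, Finset.coe_range, Set.mem_Iio]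
  by_contra hcon
  refine hp ?_
  have : m ≤ a ∨ n ≤ b ∨ m ≤ c := by omega
  rcases this with h | h | h
  · simp [pow_eq_zero_of_le h hm]
  · simp [pow_eq_zero_of_le h hn]
  · simp [pow_eq_zero_of_le h hm]

/-- One term of the triple sum on a string vector. The coefficient of `f^b` is rewritten by the
symmetry of Gaussian binomials, which makes it a function of `a` with `c` fixed. -/
theorem IsString.term_apply (hq : IsGeneric q) (h : IsString q e f k d v) {i : ℕ} (hi : i ≤ d)
    {a b c : ℕ} (hb : (b : ℤ) - a - c = d - 2 * i) :
    ((-1) ^ b * q ^ ((b : ℤ) - (a : ℤ) * (c : ℤ)) / (qFact q a * qFact q b * qFact q c)) •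
        (e ^ a) ((f ^ b) ((e ^ c) (v i)))
      = ((-1) ^ (d + a + c) * q ^ ((d : ℤ) - 2 * i + a + c - a * c) * qBinom q (d - i + c) c *
          qBinom q (d - i + a) (i - c) * qBinom q i a) • v (d - i) := by
  have hs : qBinom q ((i : ℤ) - c + b) b = qBinom q (d - i + a) (i - c) := by
    rw [show (i : ℤ) - c + b = d - i + a by omega, qBinom_symm hq (by omega)]
    congr 1
    omega
  have hsign : (-1 : F) ^ b = (-1) ^ (d + a + c) := by
    rw [show d + a + c = b + 2 * i by omega, pow_add, pow_mul]
    simp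
  have h1 := hq.qFact_ne_zero a
  have h2 := hq.qFact_ne_zero b
  have h3 := hq.qFact_ne_zero c
  rw [h.e_pow_apply hq, map_smul, map_smul, h.f_pow_apply hq, map_smul, h.e_pow_apply hq, hs,
    show (d : ℤ) - (i - c + b) + a = i by omega, show (i : ℤ) - c + b - a = d - i by omega,
    show (b : ℤ) - a * c = d - 2 * i + a + c - a * c by omega, hsign]
  simp only [smul_smul]
  congr 1
  field_simp

/-- Lusztig's triple sum reverses a string. In the sum over `a` with `c` fixed, the
`q`-Vandermonde identity leaves only `c = 0`. -/
theorem IsString.tripleSum_apply (hq : IsGeneric q) (he : IsNilpotent e) (hf : IsNilpotent f)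
    (h : IsString q e f k d v) {i : ℕ} (hi : i ≤ d) :
    tripleSum q e f (d - 2 * i) (v i)
      = ((-1) ^ (d + i) * q ^ (((d : ℤ) - i) * (i + 1))) • v (d - i) := by
  have h0 := hq.ne_zero
  -- The terms of the sum are indexed by `(a, c)`, since `b` is determined by them.
  set g : ℕ → ℕ → F := fun c a =>
    (-1) ^ (d + a + c) * q ^ ((d : ℤ) - 2 * i + a + c - a * c) * qBinom q (d - i + c) c *
      qBinom q (d - i + a) (i - c) * qBinom q i a with hg
  have hsum : tripleSum q e f (d - 2 * i) (v i)
      = (∑ c ∈ Finset.range (i + 1), ∑ a ∈ Finset.range (i + 1), g c a) • v (d - i) := by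
    set t : Finset (ℕ × ℕ) := ((Finset.range (i + 1)) ×ˢ (Finset.range (i + 1))).filter
      fun p => 2 * i ≤ d + p.2 + p.1 with ht
    set j : ℕ × ℕ → ℕ × ℕ × ℕ := fun p => (p.2, d + p.2 + p.1 - 2 * i, p.1) with hj
    have hinj : Set.InjOn j t := by
      rintro ⟨c, a⟩ - ⟨c', a'⟩ - hh
      simp only [hj, Prod.mk.injEq] at hh
      simp [hh]
    rw [QSl2.tripleSum_apply he hf,
      finsum_mem_eq_sum_of_inter_support_eq (t := t.image j), Finset.sum_image hinj]
    · rw [← Finset.sum_product', Finset.sum_smul, ht, Finset.sum_filter]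
      refine Finset.sum_congr rfl ?_
      rintro ⟨c, a⟩ hp
      simp only [Finset.mem_product, Finset.mem_range] at hp
      dsimp only
      split_ifs with hc
      · exact h.term_apply hq hi (by push_cast [hj]; omega)
      · rw [hg]
        dsimp only
        rw [qBinom_of_lt q (by omega : (0 : ℤ) ≤ d - i + a) (by omega : _ < (i : ℤ) - c)]
        simp
    · ext ⟨a, b, c⟩
      simp only [Set.mem_inter_iff, Set.mem_ofPred_eq, Finset.mem_coe, Finset.mem_image, ht, hj,
        Finset.mem_filter, Finset.mem_product, Finset.mem_range, Prod.exists, Prod.mk.injEq]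
      refine and_congr_left fun hp => ⟨fun hb => ⟨c, a, ⟨?_, by omega⟩, by omega⟩, ?_⟩
      · rw [Function.mem_support, h.term_apply hq hi hb] at hp
        constructor
        · by_contra hcon
          rw [qBinom_of_neg q _ (by omega : (i : ℤ) - c < 0)] at hp
          simp at hp
        · by_contra hcon
          rw [qBinom_of_lt q (by omega) (by omega : (i : ℤ) < a)] at hp
          simp at hp
      · rintro ⟨c', a', h1, rfl, h2, rfl⟩
        omega
  rw [hsum]
  congr 1
  have hinner : ∀ c : ℕ, ∑ a ∈ Finset.range (i + 1), g c a
      = (-1) ^ (d + c + i) * q ^ ((d : ℤ) - 2 * i + c + i * (d - i + 1)) *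
        qBinom q (d - i + c) c * qBinom q (d - i) (-c) := fun c => by
    have := sum_qBinom_mul_qBinom_add hq ((i : ℤ) - c) i (d - i)
    rw [show (i : ℤ) - c - i = -c by ring] at this
    rw [pow_add, zpow_add₀ h0]
    rw [show ∀ x y z w u t : F, x * y * (z * w) * u * t = x * z * u * (y * w * t) by
      intros; ring, ← this, Finset.mul_sum]
    refine Finset.sum_congr rfl fun a _ => ?_
    rw [hg]
    dsimp only
    rw [show (d : ℤ) - 2 * i + a + c - a * c = (d - 2 * i + c) + a * (-c + 1) by ring,
      zpow_add₀ h0]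
    ring
  simp only [hinner]
  -- Only the term with `c = 0` survives.
  rw [Finset.sum_range_succ', Finset.sum_eq_zero fun c _ => by
    rw [qBinom_of_neg q _ (by omega : -((c + 1 : ℕ) : ℤ) < 0), mul_zero]]
  simp only [Nat.cast_zero, neg_zero, qBinom_zero_right]
  rw [show (d : ℤ) - 2 * i + 0 + i * (d - i + 1) = ((d : ℤ) - i) * (i + 1) by ring]
  simp

end Lusztig

/-! ### The `q`-exponential -/

section Exponential

variable {F : Type*} [Field F] {q : F} {V : Type*} [AddCommGroup V] [Module F V]

theorem qFact_inv (q : F) (n : ℕ) : qFact q⁻¹ n = qFact q n := by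
  refine Finset.prod_congr rfl fun i _ => ?_
  rw [qInt, qInt, inv_zpow', inv_zpow', inv_inv, neg_neg, ← neg_sub q q⁻¹,
    ← neg_sub (q ^ ((i : ℤ) + 1)), neg_div_neg_eq]

theorem two_mul_choose_two (n : ℕ) : 2 * ((n.choose 2 : ℕ) : ℤ) = n * (n - 1) := by
  induction n with
  | zero => simp
  | succ n ih =>
    rw [Nat.choose_succ_succ', Nat.choose_one_right]
    push_cast
    linear_combination ih

theorem expq_eq_sum {φ : Module.End F V} {n : ℕ} (hn : φ ^ n = 0) :
    expq q φ = ∑ i ∈ Finset.range n, (q ^ i.choose 2 / qFact q i) • φ ^ i := by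
  refine finsum_eq_finsetSum_of_support_subset _ fun i hi => ?_
  rw [Finset.coe_range, Set.mem_Iio]
  by_contra hcon
  exact hi (by simp [pow_eq_zero_of_le (not_lt.1 hcon) hn])

theorem expq_apply {φ : Module.End F V} (hφ : IsNilpotent φ) {w : V} {n : ℕ}
    (hw : (φ ^ n) w = 0) :
    expq q φ w = ∑ i ∈ Finset.range n, (q ^ i.choose 2 / qFact q i) • (φ ^ i) w := by
  obtain ⟨m, hm⟩ := hφ
  rw [expq_eq_sum (pow_eq_zero_of_le (le_max_left m n) hm), LinearMap.sum_apply]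
  refine (Finset.sum_subset (Finset.range_mono (le_max_right m n)) fun i _ hi => ?_).symm
  obtain ⟨r, rfl⟩ := Nat.exists_eq_add_of_le (not_lt.1 fun h => hi (Finset.mem_range.2 h))
  rw [LinearMap.smul_apply, add_comm, pow_add, Module.End.mul_apply, hw, map_zero, smul_zero]

/-- The coefficients of `exp_q(X)` and of `exp_{q⁻¹}(-X)` are inverse to each other as power
series. -/
theorem sum_antidiagonal_expq (hq : IsGeneric q) (n : ℕ) :
    ∑ p ∈ Finset.HasAntidiagonal.antidiagonal n, q ^ p.1.choose 2 / qFact q p.1 *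
      ((-1) ^ p.2 * q⁻¹ ^ p.2.choose 2 / qFact q p.2) = if n = 0 then 1 else 0 := by
  have h0 := hq.ne_zero
  have h := sum_qBinom_mul_qBinom_add hq 0 n 0
  have hterm : ∀ p ∈ Finset.HasAntidiagonal.antidiagonal n, q ^ p.1.choose 2 / qFact q p.1 *
      ((-1) ^ p.2 * q⁻¹ ^ p.2.choose 2 / qFact q p.2) = q ^ n.choose 2 / qFact q n *
        ((-1) ^ p.2 * q ^ ((p.2 : ℤ) * (0 - n + 1)) * qBinom q n p.2 *
          qBinom q (0 + p.2) 0) := by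
    rintro ⟨b, a⟩ hab
    obtain rfl := Finset.HasAntidiagonal.mem_antidiagonal.1 hab
    have h1 := qBinom_mul_qFact hq a b
    have h2 := hq.qFact_ne_zero a
    have h3 := hq.qFact_ne_zero b
    have h4 := hq.qFact_ne_zero (b + a)
    have hpow : q ^ b.choose 2 * q⁻¹ ^ a.choose 2
        = q ^ (b + a).choose 2 * q ^ ((a : ℤ) * (0 - (b + a : ℕ) + 1)) := by
      rw [inv_pow, ← zpow_natCast, ← zpow_natCast, ← zpow_natCast, ← zpow_neg, ← zpow_add₀ h0,
        ← zpow_add₀ h0]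
      congr 1
      have e1 := two_mul_choose_two a
      have e2 := two_mul_choose_two b
      have e3 := two_mul_choose_two (b + a)
      apply mul_left_cancel₀ (two_ne_zero (α := ℤ))
      push_cast at e3 ⊢
      linear_combination e2 - e1 - e3
    rw [qBinom_zero_right, Nat.cast_add, add_comm (b : ℤ)]
    rw [add_comm a b] at h1
    rw [Nat.cast_add, add_comm (b : ℤ)] at hpow
    dsimp only
    field_simp
    linear_combination qFact q (b + a) * hpow -
      q ^ (b + a).choose 2 * q ^ ((a : ℤ) * (0 - (a + b) + 1)) * h1
  rw [Finset.sum_congr rfl hterm, ← Finset.mul_sum,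
    ← Finset.Nat.sum_antidiagonal_swap, Finset.Nat.sum_antidiagonal_eq_sum_range_succ_mk]
  dsimp only [Prod.swap]
  rw [h]
  split_ifs with hn
  · subst hn
    simp [qBinom_zero_right, qFact_zero]
  · rw [qBinom_of_neg q _ (by omega : 0 - (n : ℤ) < 0)]
    simp

theorem neg_pow_eq_smul (φ : Module.End F V) (n : ℕ) : (-φ) ^ n = (-1 : F) ^ n • φ ^ n := by
  rw [← smul_pow, neg_one_smul]

/-- The inverse of `exp_q(φ)` is `exp_{q⁻¹}(-φ)`. -/
theorem expq_mul_expq_inv_neg (hq : IsGeneric q) {φ : Module.End F V} (hφ : IsNilpotent φ) :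
    expq q φ * expq q⁻¹ (-φ) = 1 := by
  obtain ⟨n, hn⟩ := hφ
  have hn' : (-φ) ^ n = 0 := by rw [neg_pow, hn, mul_zero]
  -- Both exponentials are values at `φ` of polynomials whose product is `1` modulo `X ^ n`.
  set P : Polynomial F := ∑ i ∈ Finset.range n, Polynomial.monomial i (q ^ i.choose 2 / qFact q i)
  set Q : Polynomial F := ∑ i ∈ Finset.range n,
    Polynomial.monomial i ((-1) ^ i * q⁻¹ ^ i.choose 2 / qFact q i)
  have hP : expq q φ = Polynomial.aeval φ P := by
    simp [P, expq_eq_sum hn, Polynomial.aeval_monomial, Algebra.smul_def]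
  have hQ : expq q⁻¹ (-φ) = Polynomial.aeval φ Q := by
    rw [expq_eq_sum hn', map_sum]
    refine Finset.sum_congr rfl fun i _ => ?_
    rw [Polynomial.aeval_monomial, qFact_inv, ← Algebra.smul_def, neg_pow_eq_smul, smul_smul,
      mul_comm, mul_div_assoc]
  have hdvd : Polynomial.X ^ n ∣ P * Q - 1 := by
    rw [Polynomial.X_pow_dvd_iff]
    intro m hm
    rw [Polynomial.coeff_sub, Polynomial.coeff_mul, Polynomial.coeff_one,
      ← sum_antidiagonal_expq hq m, sub_eq_zero]
    refine Finset.sum_congr rfl ?_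
    rintro ⟨a, b⟩ hab
    have := Finset.HasAntidiagonal.mem_antidiagonal.1 hab
    dsimp only at this ⊢
    simp only [P, Q, Polynomial.finsetSum_coeff, Polynomial.coeff_monomial]
    rw [Finset.sum_ite_eq', Finset.sum_ite_eq', if_pos (Finset.mem_range.2 (by omega)),
      if_pos (Finset.mem_range.2 (by omega))]
  obtain ⟨R, hR⟩ := hdvd
  rw [hP, hQ, ← map_mul, eq_add_of_sub_eq hR, map_add, map_mul, map_pow, Polynomial.aeval_X, hn,
    zero_mul, zero_add, map_one]

/-- A sum over the powers of a lowering operator, written as a sum over the vectors of the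
family. -/
theorem sum_pow_apply_of_lower (hq : IsGeneric q) {φ : Module.End F V} {u : ℤ → V} {d : ℕ}
    (h : ∀ i, φ (u i) = qInt q (d - i + 1) • u (i - 1)) (c : ℤ → F) {j : ℕ} (hj : j ≤ d) :
    ∑ m ∈ Finset.range (j + 1), (c m / qFact q m) • (φ ^ m) (u j)
      = ∑ i ∈ Finset.range (d + 1), (c (j - i) * qBinom q (d - i) (d - j)) • u i := by
  rw [← Finset.sum_subset (Finset.range_mono (by omega : j + 1 ≤ d + 1)),
    ← Finset.sum_range_reflect]
  · refine Finset.sum_congr rfl fun m hm => ?_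
    have hm' : m ≤ j := by simpa [Nat.lt_succ_iff] using hm
    have e : ((j + 1 - 1 - m : ℕ) : ℤ) = j - m := by omega
    have := hq.qFact_ne_zero (j + 1 - 1 - m)
    rw [pow_apply_of_lower hq h, smul_smul, e, sub_sub_cancel,
      qBinom_symm hq (by omega : (0 : ℤ) ≤ d - j + (j - m)),
      show (d : ℤ) - j + (j - m) = d - m by ring, show (d : ℤ) - m - (j - m) = d - j by ring]
    congr 1
    field_simp
  · intro i hi hi'
    simp only [Finset.mem_range] at hi hi'
    rw [qBinom_of_lt q (by omega : (0 : ℤ) ≤ d - i) (by omega), mul_zero, zero_smul]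

theorem pow_apply_eq_zero_of_lower (hq : IsGeneric q) {φ : Module.End F V} {u : ℤ → V} {d : ℕ}
    (h0 : ∀ i, i < 0 → u i = 0)
    (h : ∀ i, φ (u i) = qInt q (d - i + 1) • u (i - 1)) (j : ℕ) :
    (φ ^ (j + 1)) (u j) = 0 := by
  rw [pow_apply_of_lower hq h, h0 _ (by push_cast; omega), smul_zero]

variable {p : F}

theorem pow_choose_two (hp : p ^ 2 = q) (n : ℕ) :
    q ^ n.choose 2 = p ^ ((n : ℤ) * (n - 1)) := by
  rw [← hp, ← pow_mul, ← zpow_natCast, ← two_mul_choose_two]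
  push_cast
  rfl

theorem expq_apply_of_lower (hq : IsGeneric q) (hp : p ^ 2 = q) {φ : Module.End F V}
    (hφ : IsNilpotent φ) {u : ℤ → V} {d : ℕ} (h0 : ∀ i, i < 0 → u i = 0)
    (h : ∀ i, φ (u i) = qInt q (d - i + 1) • u (i - 1)) {j : ℕ} (hj : j ≤ d) :
    expq q φ (u j) = ∑ i ∈ Finset.range (d + 1),
      (p ^ (((j : ℤ) - i) * (j - i - 1)) * qBinom q (d - i) (d - j)) • u i := by
  rw [expq_apply hφ (pow_apply_eq_zero_of_lower hq h0 h j),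
    ← sum_pow_apply_of_lower hq h (fun z => p ^ (z * (z - 1))) hj]
  simp only [pow_choose_two hp]

theorem expq_inv_neg_apply_of_lower (hq : IsGeneric q) (hp : p ^ 2 = q) {φ : Module.End F V}
    (hφ : IsNilpotent φ) {u : ℤ → V} {d : ℕ} (h0 : ∀ i, i < 0 → u i = 0)
    (h : ∀ i, φ (u i) = qInt q (d - i + 1) • u (i - 1)) {j : ℕ} (hj : j ≤ d) :
    expq q⁻¹ (-φ) (u j) = ∑ i ∈ Finset.range (d + 1),
      ((-1) ^ ((j : ℤ) - i) * p ^ (-(((j : ℤ) - i) * (j - i - 1))) *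
        qBinom q (d - i) (d - j)) • u i := by
  rw [expq_apply hφ.neg (n := j + 1),
    ← sum_pow_apply_of_lower hq h (fun z => (-1) ^ z * p ^ (-(z * (z - 1)))) hj]
  · refine Finset.sum_congr rfl fun m _ => ?_
    rw [qFact_inv, neg_pow_eq_smul, LinearMap.smul_apply, smul_smul, inv_pow,
      pow_choose_two hp, ← zpow_neg, zpow_natCast]
    congr 1
    ring
  · rw [neg_pow_eq_smul, LinearMap.smul_apply, pow_apply_eq_zero_of_lower hq h0 h, smul_zero]

theorem expq_apply_of_raise (hq : IsGeneric q) (hp : p ^ 2 = q) {ψ : Module.End F V}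
    (hψ : IsNilpotent ψ) {u : ℤ → V} {d : ℕ} (h0 : ∀ i, (d : ℤ) < i → u i = 0)
    (h : ∀ i, ψ (u i) = qInt q (i + 1) • u (i + 1)) {j : ℕ} (hj : j ≤ d) :
    expq q ψ (u j) = ∑ i ∈ Finset.range (d + 1),
      (p ^ (((i : ℤ) - j) * (i - j - 1)) * qBinom q i j) • u i := by
  -- Reversing the family turns `ψ` into a lowering operator.
  have := expq_apply_of_lower hq hp hψ (u := fun i => u (d - i)) (d := d)
    (fun i hi => h0 _ (by omega)) (fun i => by rw [h]; congr 2; ring) (Nat.sub_le d j)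
  rw [← Finset.sum_range_reflect] at this
  rw [show (d : ℤ) - (d - j : ℕ) = j by omega] at this
  rw [this]
  refine Finset.sum_congr rfl fun i hi => ?_
  have hi' : i < d + 1 := Finset.mem_range.1 hi
  rw [show ((d + 1 - 1 - i : ℕ) : ℤ) = d - i by omega, show ((d - j : ℕ) : ℤ) = d - j by omega,
    sub_sub_cancel, sub_sub_sub_cancel_left]

end Exponential

/-! ### The product of exponentials on a string -/

section Rotator

variable {F : Type*} [Field F] {q p : F} {V : Type*} [AddCommGroup V] [Module F V]

/-- The matrix entries of `exp_q(ψ) Υ exp_q(φ)` and of a multiple of `exp_{q⁻¹}(-φ)`, in a basis on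
which `φ` lowers, agree by the `q`-Vandermonde identity. The square root `p` of `q` makes all
exponents integer polynomials in the indices. -/
theorem sum_entries (hq : IsGeneric q) (hp : p ^ 2 = q) {d j l : ℕ} (hl : l ≤ d) :
    ∑ i ∈ Finset.range (d + 1),
        p ^ (((j : ℤ) - i) * (j - i - 1)) * qBinom q (d - i) (d - j) *
          p ^ (-(((d : ℤ) - 2 * i) ^ 2)) * ((-1) ^ i * p ^ (-(2 * (i : ℤ) * (d - i)))) *
          (p ^ (((l : ℤ) - i) * (l - i - 1)) * qBinom q l i) *
          ((-1) ^ (l : ℤ) * p ^ (2 * (l : ℤ) * (d - l)))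
      = (-1) ^ ((d : ℤ) - j) * p ^ (-(d : ℤ) - 2 * j * (d - j)) *
          ((-1) ^ ((d : ℤ) - j - l) * p ^ (-(((d : ℤ) - j - l) * (d - j - l - 1))) *
            qBinom q (d - l) j) := by
  have hp0 : p ≠ 0 := by
    rintro rfl
    exact hq.ne_zero (by rw [← hp]; ring)
  have hqz : ∀ z : ℤ, q ^ z = p ^ (2 * z) := fun z => by
    rw [← hp, zpow_mul, zpow_ofNat]
  have hs : (-1 : F) ^ ((d : ℤ) - j) * (-1) ^ ((d : ℤ) - j - l) = (-1) ^ (l : ℤ) := by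
    have h1 : (-1 : F) ≠ 0 := by simp
    rw [← zpow_add₀ h1, show (d : ℤ) - j + (d - j - l) = 2 * (d - j - l) + l by ring,
      zpow_add₀ h1, zpow_mul]
    simp
  have h := sum_qBinom_mul_qBinom_sub hq ((d : ℤ) - j) l d
  rw [hqz, show (d : ℤ) - j - l = d - l - j by ring,
    ← qBinom_symm hq (by omega : (0 : ℤ) ≤ d - l) j] at h
  rw [show ∀ a b c e g : F, a * b * (c * e * g) = (a * c) * (b * e * g) by intros; ring, hs]
  have hlast : p ^ (-(d : ℤ) - 2 * j * (d - j)) * p ^ (-(((d : ℤ) - j - l) * (d - j - l - 1)))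
      = p ^ ((j : ℤ) * (j - 1) - d ^ 2 + l * (l - 1) + 2 * (l : ℤ) * (d - l)) *
        p ^ (2 * (-((l : ℤ) * (d - (d - j))))) := by
    rw [← zpow_add₀ hp0, ← zpow_add₀ hp0]
    congr 1
    ring
  rw [hlast, mul_assoc _ _ (qBinom q _ _), ← h,
    ← Finset.sum_subset (Finset.range_mono (by omega : l + 1 ≤ d + 1)), Finset.mul_sum,
    Finset.mul_sum]
  · refine Finset.sum_congr rfl fun i _ => ?_
    have e : p ^ (((j : ℤ) - i) * (j - i - 1)) * p ^ (-(((d : ℤ) - 2 * i) ^ 2)) *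
          p ^ (-(2 * (i : ℤ) * (d - i))) * p ^ (((l : ℤ) - i) * (l - i - 1)) *
          p ^ (2 * (l : ℤ) * (d - l))
        = p ^ ((j : ℤ) * (j - 1) - d ^ 2 + l * (l - 1) + 2 * (l : ℤ) * (d - l)) *
          p ^ (2 * ((i : ℤ) * (d - l - j + 1))) := by
      simp only [← zpow_add₀ hp0]
      congr 1
      ring
    rw [hqz]
    linear_combination (qBinom q (d - i) (d - j) * qBinom q l i * (-1) ^ i * (-1) ^ (l : ℤ)) * e
  · intro i _ hi
    rw [qBinom_of_lt q (by omega : (0 : ℤ) ≤ l)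
      (by have := Finset.mem_range.not.1 hi; omega : (l : ℤ) < i)]
    ring

/-- If `φ` lowers a family `u` and `ψ` raises its multiples by `(-1) ^ i q ^ (i (d - i))`, then the
product of exponentials reverses `u`, up to scalars. -/
theorem rotator_apply (hq : IsGeneric q) (hp : p ^ 2 = q) {φ ψ Υ : Module.End F V}
    (hφ : IsNilpotent φ) (hψ : IsNilpotent ψ) {u : ℤ → V} {d : ℕ}
    (h0 : ∀ i, i < 0 ∨ (d : ℤ) < i → u i = 0)
    (hu : ∀ i, φ (u i) = qInt q (d - i + 1) • u (i - 1))
    (hu' : ∀ i : ℤ, ψ (((-1) ^ i * q ^ (i * (d - i))) • u i)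
      = qInt q (i + 1) • ((-1) ^ (i + 1) * q ^ ((i + 1) * (d - (i + 1)))) • u (i + 1))
    (hΥ : ∀ i, Υ (u i) = p ^ (-(((d : ℤ) - 2 * i) ^ 2)) • u i) {j : ℕ} (hj : j ≤ d) :
    (expq q φ * (expq q ψ * Υ * expq q φ)) (u j)
      = ((-1) ^ ((d : ℤ) - j) * p ^ (-(d : ℤ) - 2 * j * (d - j))) • u (d - j) := by
  have hp0 : p ≠ 0 := by
    rintro rfl
    exact hq.ne_zero (by rw [← hp]; ring)
  have hqz : ∀ z : ℤ, q ^ z = p ^ (2 * z) := fun z => by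
    rw [← hp, zpow_mul, zpow_ofNat]
  have hraise : ∀ i : ℕ, i ≤ d → expq q ψ (u i) = ∑ l ∈ Finset.range (d + 1),
      (((-1) ^ i * p ^ (-(2 * (i : ℤ) * (d - i)))) *
          (p ^ (((l : ℤ) - i) * (l - i - 1)) * qBinom q l i) *
          ((-1) ^ (l : ℤ) * p ^ (2 * (l : ℤ) * (d - l)))) • u l := fun i hi => by
    have h := expq_apply_of_raise hq hp hψ
      (u := fun i => ((-1) ^ i * q ^ (i * ((d : ℤ) - i))) • u i) (d := d)
      (fun i hi => by rw [h0 i (Or.inr hi), smul_zero]) hu' hi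
    have hone : ((-1) ^ i * p ^ (-(2 * (i : ℤ) * (d - i)))) *
        ((-1) ^ (i : ℤ) * q ^ (i * ((d : ℤ) - i))) = 1 := by
      rw [hqz, zpow_neg, zpow_natCast, mul_mul_mul_comm, ← mul_pow, mul_assoc 2 (i : ℤ),
        inv_mul_cancel₀ (zpow_ne_zero _ hp0)]
      simp
    have h' := congrArg (((-1) ^ i * p ^ (-(2 * (i : ℤ) * (d - i)))) • ·) h
    rw [map_smul, smul_smul, hone, one_smul, Finset.smul_sum] at h'
    rw [h']
    refine Finset.sum_congr rfl fun l _ => ?_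
    rw [smul_smul, smul_smul, hqz, mul_assoc 2 (l : ℤ), mul_assoc]
  have hmain : (expq q ψ * Υ * expq q φ) (u j)
      = ((-1) ^ ((d : ℤ) - j) * p ^ (-(d : ℤ) - 2 * j * (d - j))) •
        expq q⁻¹ (-φ) (u (d - j)) := by
    have h := expq_inv_neg_apply_of_lower hq hp hφ (fun i hi => h0 i (Or.inl hi)) hu
      (Nat.sub_le d j)
    rw [show ((d - j : ℕ) : ℤ) = d - j by omega, sub_sub_cancel] at h
    rw [h, Module.End.mul_apply, Module.End.mul_apply,
      expq_apply_of_lower hq hp hφ (fun i hi => h0 i (Or.inl hi)) hu hj, map_sum, map_sum,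
      Finset.smul_sum]
    have hterm : ∀ i ∈ Finset.range (d + 1), expq q ψ
        (Υ ((p ^ (((j : ℤ) - i) * (j - i - 1)) * qBinom q (d - i) (d - j)) • u i))
          = ∑ l ∈ Finset.range (d + 1), (p ^ (((j : ℤ) - i) * (j - i - 1)) *
              qBinom q (d - i) (d - j) * p ^ (-(((d : ℤ) - 2 * i) ^ 2)) *
              ((-1) ^ i * p ^ (-(2 * (i : ℤ) * (d - i)))) *
              (p ^ (((l : ℤ) - i) * (l - i - 1)) * qBinom q l i) *
              ((-1) ^ (l : ℤ) * p ^ (2 * (l : ℤ) * (d - l)))) • u l := fun i hi => by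
      rw [map_smul, hΥ, map_smul, map_smul, hraise i (by simpa [Nat.lt_succ_iff] using hi),
        Finset.smul_sum, Finset.smul_sum]
      refine Finset.sum_congr rfl fun l _ => ?_
      rw [smul_smul, smul_smul]
      congr 1
      ring
    rw [Finset.sum_congr rfl hterm, Finset.sum_comm]
    refine Finset.sum_congr rfl fun l hl => ?_
    rw [← Finset.sum_smul, sum_entries hq hp (by simpa [Nat.lt_succ_iff] using hl), smul_smul]
  rw [Module.End.mul_apply, hmain, map_smul, ← Module.End.mul_apply,
    expq_mul_expq_inv_neg hq hφ, Module.End.one_apply]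

end Rotator

/-! ### Equitable nilpotents on a string -/

section Identification

variable {F : Type*} [Field F] {q θ : F} {V : Type*} [AddCommGroup V] [Module F V]
variable {e f : Module.End F V} {k : (Module.End F V)ˣ} {d : ℕ} {v : ℤ → V}

/-- The endomorphism `n_z = q (1 - x y) / (q - q⁻¹)`, with `x` and `y` expressed through `e` and `k`
by the identification of type `(θ, t)`. -/
noncomputable def nilZ (q θ : F) (t : ℤ) (e : Module.End F V) (k : (Module.End F V)ˣ) :
    Module.End F V :=
  (q - q⁻¹)⁻¹ • (q • (1 - (((k⁻¹ : (Module.End F V)ˣ) : Module.End F V) -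
    (q ^ (1 + t) * (q - q⁻¹) * θ⁻¹) • (((k ^ (-1 - t) : (Module.End F V)ˣ) : Module.End F V) * e)) *
      (k : Module.End F V)))

/-- The endomorphism `n_x = q (1 - y z) / (q - q⁻¹)`, with `y` and `z` expressed through `f` and `k`
by the identification of type `(θ, t)`. -/
noncomputable def nilX (q θ : F) (t : ℤ) (f : Module.End F V) (k : (Module.End F V)ˣ) :
    Module.End F V :=
  (q - q⁻¹)⁻¹ • (q • (1 - (k : Module.End F V) *
    (((k⁻¹ : (Module.End F V)ˣ) : Module.End F V) +
      (q ^ (-t) * (q - q⁻¹) * θ) • (f * ((k ^ t : (Module.End F V)ˣ) : Module.End F V)))))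

theorem IsString.nilZ_apply (hq : IsGeneric q) (h : IsString q e f k d v) (t i : ℤ) :
    nilZ q θ t e k (v i)
      = (θ⁻¹ * q ^ (t - t * (d - 2 * i + 2)) * qInt q (d - i + 1)) • v (i - 1) := by
  have h0 := hq.ne_zero
  have h1 : q ^ 2 - 1 ≠ 0 := sub_ne_zero.2 (hq.not_root 2 two_pos)
  have e1 : q * q ^ (1 + t) * q ^ ((-1 - t) * ((d : ℤ) - 2 * (i - 1))) * q ^ ((d : ℤ) - 2 * i)
      = q ^ (t - t * (d - 2 * i + 2)) := by
    rw [← zpow_one_add₀ h0, ← zpow_add₀ h0, ← zpow_add₀ h0]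
    congr 1
    ring
  rw [nilZ, sub_mul, Units.inv_mul, sub_sub_cancel, ← e1]
  simp only [LinearMap.smul_apply, Module.End.mul_apply, h.k_apply, map_smul, h.e_apply,
    h.k_zpow_apply hq, smul_smul]
  congr 1
  field_simp

theorem IsString.nilX_apply (hq : IsGeneric q) (h : IsString q e f k d v) (t i : ℤ) :
    nilX q θ t f k (v i)
      = (-(θ * q ^ (t * (d - 2 * i - 1) + (d - 2 * i - 1)) * qInt q (i + 1))) • v (i + 1) := by
  have h0 := hq.ne_zero
  have h1 : q ^ 2 - 1 ≠ 0 := sub_ne_zero.2 (hq.not_root 2 two_pos)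
  have e1 : q * q ^ (-t) * q ^ (t * ((d : ℤ) - 2 * i)) * q ^ ((d : ℤ) - 2 * (i + 1))
      = q ^ (t * (d - 2 * i - 1) + (d - 2 * i - 1)) := by
    rw [← zpow_one_add₀ h0, ← zpow_add₀ h0, ← zpow_add₀ h0]
    congr 1
    ring
  rw [nilX, mul_add, Units.mul_inv, sub_add_cancel_left, ← e1]
  simp only [LinearMap.smul_apply, LinearMap.neg_apply, Module.End.mul_apply, h.k_apply, map_smul,
    h.f_apply, h.k_zpow_apply hq, smul_smul, smul_neg, neg_smul]
  congr 2
  field_simp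

/-- After rescaling, `n_z` acts on a string without the parameters `θ` and `t`. -/
theorem IsString.nilZ_apply_rescaled (hq : IsGeneric q) (hθ : θ ≠ 0) (h : IsString q e f k d v)
    (t i : ℤ) :
    nilZ q θ t e k ((θ ^ i * q ^ (t * (i * (d - i)))) • v i)
      = qInt q (d - i + 1) • (θ ^ (i - 1) * q ^ (t * ((i - 1) * (d - (i - 1))))) • v (i - 1) := by
  have h0 := hq.ne_zero
  have e1 : q ^ (t * (i * (d - i))) * q ^ (t - t * (d - 2 * i + 2))
      = q ^ (t * ((i - 1) * (d - (i - 1)))) := by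
    rw [← zpow_add₀ h0]
    congr 1
    ring
  rw [map_smul, h.nilZ_apply hq, smul_smul, smul_smul, zpow_sub_one₀ hθ, ← e1]
  congr 1
  ring

/-- After rescaling, `n_x` acts on a string without the parameters `θ` and `t`. -/
theorem IsString.nilX_apply_rescaled (hq : IsGeneric q) (hθ : θ ≠ 0) (h : IsString q e f k d v)
    (t i : ℤ) :
    nilX q θ t f k (((-1) ^ i * q ^ (i * (d - i))) • (θ ^ i * q ^ (t * (i * (d - i)))) • v i)
      = qInt q (i + 1) • ((-1) ^ (i + 1) * q ^ ((i + 1) * (d - (i + 1)))) •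
        (θ ^ (i + 1) * q ^ (t * ((i + 1) * (d - (i + 1))))) • v (i + 1) := by
  have h0 := hq.ne_zero
  have e1 : q ^ (i * (d - i)) * q ^ (t * (i * (d - i))) *
      q ^ (t * (d - 2 * i - 1) + (d - 2 * i - 1))
      = q ^ ((i + 1) * (d - (i + 1))) * q ^ (t * ((i + 1) * (d - (i + 1)))) := by
    rw [← zpow_add₀ h0, ← zpow_add₀ h0, ← zpow_add₀ h0]
    congr 1
    ring
  rw [map_smul, map_smul, h.nilX_apply hq]
  simp only [smul_smul]
  rw [zpow_add_one₀ hθ, zpow_add_one₀ (by simp : (-1 : F) ≠ 0)]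
  congr 1
  linear_combination (-((-1) ^ i * θ ^ i * θ * qInt q (i + 1))) * e1

/-- The product of exponentials reverses each string, up to scalars that do not depend on `t`. -/
theorem IsString.expq_rotator_apply {p : F} (hq : IsGeneric q) (hp : p ^ 2 = q) (hθ : θ ≠ 0)
    (t : ℤ) (h : IsString q e f k d v) (hZ : IsNilpotent (nilZ q θ t e k))
    (hX : IsNilpotent (nilX q θ t f k)) {Υ : Module.End F V}
    (hΥ : ∀ i, Υ (v i) = p ^ (-(((d : ℤ) - 2 * i) ^ 2)) • v i) {j : ℕ} (hj : j ≤ d) :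
    (expq q (nilZ q θ t e k) * (expq q (nilX q θ t f k) * Υ * expq q (nilZ q θ t e k))) (v j)
      = ((-1) ^ ((d : ℤ) - j) * p ^ (-(d : ℤ) - 2 * j * (d - j)) * θ ^ ((d : ℤ) - 2 * j)) •
        v (d - j) := by
  have h0 := hq.ne_zero
  have key := rotator_apply hq hp (Υ := Υ) hZ hX
    (u := fun i => (θ ^ i * q ^ (t * (i * ((d : ℤ) - i)))) • v i) (d := d)
    (fun i hi => by rw [h.eq_zero i hi, smul_zero]) (h.nilZ_apply_rescaled hq hθ t)
    (h.nilX_apply_rescaled hq hθ t) (fun i => by rw [map_smul, hΥ, smul_comm]) hj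
  have hc : θ ^ (j : ℤ) * q ^ (t * (j * ((d : ℤ) - j))) ≠ 0 :=
    mul_ne_zero (zpow_ne_zero _ hθ) (zpow_ne_zero _ h0)
  rw [map_smul] at key
  rw [← smul_right_inj hc, key]
  simp only [smul_smul]
  rw [show (d : ℤ) - j = j + (d - 2 * j) by ring, zpow_add₀ hθ]
  congr 1
  ring_nf

end Identification

/-! ### Modules spanned by strings -/

section Spanned

variable {F : Type*} [Field F] {q : F} {V : Type*} [AddCommGroup V] [Module F V]
variable {e f : Module.End F V} {k : (Module.End F V)ˣ}

/-- The module is spanned by strings: a subspace that contains the vectors of every string is the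
whole module. -/
def SpannedByStrings (q : F) (e f : Module.End F V) (k : (Module.End F V)ˣ) : Prop :=
  ∀ M : Submodule F V, (∀ (d : ℕ) (v : ℤ → V), IsString q e f k d v →
    ∀ j : ℕ, j ≤ d → v j ∈ M) → M = ⊤

theorem SpannedByStrings.reverse (hq : IsGeneric q) (hV : SpannedByStrings q e f k) :
    SpannedByStrings q f e k⁻¹ := by
  refine fun M hM => hV M fun d v hs j hj => ?_
  have := hM d _ (hs.reverse hq) (d - j) (Nat.sub_le d j)
  rwa [show (d : ℤ) - (d - j : ℕ) = j by omega] at this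

theorem SpannedByStrings.isNilpotent [FiniteDimensional F V] (hV : SpannedByStrings q e f k)
    {φ : Module.End F V} (hφ : ∀ (d : ℕ) (v : ℤ → V), IsString q e f k d v →
      ∀ j : ℕ, j ≤ d → ∃ m, (φ ^ m) (v j) = 0) : IsNilpotent φ := by
  rw [Module.End.isNilpotent_iff_of_finite]
  have h := hV (φ.maxGenEigenspace 0) fun d v hs j hj => by
    obtain ⟨m, hm⟩ := hφ d v hs j hj
    exact Module.End.mem_maxGenEigenspace _ _ _ |>.2 ⟨m, by simpa using hm⟩
  intro w
  obtain ⟨m, hm⟩ := (Module.End.mem_maxGenEigenspace φ 0 w).1 (h ▸ Submodule.mem_top)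
  exact ⟨m, by simpa using hm⟩

theorem SpannedByStrings.isUnit_and_inverse_eq [FiniteDimensional F V]
    (hV : SpannedByStrings q e f k) {T S : Module.End F V}
    (h : ∀ (d : ℕ) (v : ℤ → V), IsString q e f k d v → ∀ j : ℕ, j ≤ d → S (T (v j)) = v j) :
    IsUnit T ∧ Ring.inverse T = S := by
  have hST : S * T = 1 := LinearMap.eqLocus_eq_top.1 (hV (LinearMap.eqLocus (S * T) 1) h)
  have hTS : T * S = 1 := mul_eq_one_comm.1 hST
  exact ⟨⟨⟨T, S, hTS, hST⟩, rfl⟩, Ring.inverse_unit ⟨T, S, hTS, hST⟩⟩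

theorem SpannedByStrings.isNilpotent_e [FiniteDimensional F V] (hq : IsGeneric q)
    (hV : SpannedByStrings q e f k) : IsNilpotent e :=
  hV.isNilpotent fun _ _ hs j _ => ⟨j + 1, pow_apply_eq_zero_of_lower hq
    (fun i hi => hs.eq_zero i (Or.inl hi)) hs.e_apply j⟩

theorem SpannedByStrings.isNilpotent_f [FiniteDimensional F V] (hq : IsGeneric q)
    (hV : SpannedByStrings q e f k) : IsNilpotent f :=
  (hV.reverse hq).isNilpotent_e hq

theorem SpannedByStrings.isNilpotent_nilZ [FiniteDimensional F V] (hq : IsGeneric q) {θ : F}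
    (hθ : θ ≠ 0) (t : ℤ) (hV : SpannedByStrings q e f k) : IsNilpotent (nilZ q θ t e k) :=
  hV.isNilpotent fun d v hs j _ => by
    have := pow_apply_eq_zero_of_lower hq (d := d)
      (u := fun i => (θ ^ i * q ^ (t * (i * ((d : ℤ) - i)))) • v i)
      (fun i hi => by rw [hs.eq_zero i (Or.inl hi), smul_zero]) (hs.nilZ_apply_rescaled hq hθ t) j
    rw [map_smul, smul_eq_zero_iff_right
      (mul_ne_zero (zpow_ne_zero _ hθ) (zpow_ne_zero _ hq.ne_zero))] at this
    exact ⟨j + 1, this⟩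

theorem SpannedByStrings.isNilpotent_nilX [FiniteDimensional F V] (hq : IsGeneric q) {θ : F}
    (hθ : θ ≠ 0) (t : ℤ) (hV : SpannedByStrings q e f k) : IsNilpotent (nilX q θ t f k) :=
  hV.isNilpotent fun d v hs j hj => by
    set w : ℤ → V := fun i =>
      ((-1) ^ i * q ^ (i * (d - i))) • (θ ^ i * q ^ (t * (i * (d - i)))) • v i with hw
    have h := pow_apply_of_raise hq (v := w) (hs.nilX_apply_rescaled hq hθ t) (d + 1) j
    have hz : w (j + (d + 1 : ℕ)) = 0 := by
      rw [hw]
      dsimp only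
      rw [hs.eq_zero _ (Or.inr (by push_cast; omega)), smul_zero, smul_zero]
    rw [hz, smul_zero, hw, map_smul, map_smul, smul_eq_zero_iff_right (mul_ne_zero
      (zpow_ne_zero _ (by simp)) (zpow_ne_zero _ hq.ne_zero)), smul_eq_zero_iff_right
      (mul_ne_zero (zpow_ne_zero _ hθ) (zpow_ne_zero _ hq.ne_zero))] at h
    exact ⟨d + 1, h⟩

/-- The inverse of an operator that is the triple sum in `e`, `f`, `e` on each weight space. -/
theorem SpannedByStrings.inverse_eq [FiniteDimensional F V] (hq : IsGeneric q) {θ : F}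
    (hθ : θ ≠ 0) (hθq : θ ^ 2 = q) (t : ℤ) (hV : SpannedByStrings q e f k)
    {T Υ : Module.End F V}
    (hT : ∀ (d : ℕ) (v : ℤ → V), IsString q e f k d v → ∀ j : ℤ,
      T (v j) = tripleSum q e f (d - 2 * j) (v j))
    (hΥ : ∀ (d : ℕ) (v : ℤ → V), IsString q e f k d v → ∀ j : ℤ,
      Υ (v j) = (-θ) ^ (-(((d : ℤ) - 2 * j) ^ 2)) • v j) :
    IsUnit T ∧ Ring.inverse T = expq q (nilZ q θ t e k) *
      (expq q (nilX q θ t f k) * Υ * expq q (nilZ q θ t e k)) := by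
  refine hV.isUnit_and_inverse_eq fun d v hs j hj => ?_
  have h := hs.expq_rotator_apply (p := -θ) hq (by rw [neg_sq, hθq]) hθ t
    (hV.isNilpotent_nilZ hq hθ t) (hV.isNilpotent_nilX hq hθ t) (hΥ d v hs) (Nat.sub_le d j)
  rw [show ((d - j : ℕ) : ℤ) = d - j by omega, sub_sub_cancel] at h
  rw [hT d v hs, hs.tripleSum_apply hq (hV.isNilpotent_e hq) (hV.isNilpotent_f hq) hj, map_smul, h,
    smul_smul]
  have h1 : (-1 : F) ≠ 0 := by simp
  rw [← hθq, neg_eq_neg_one_mul θ, mul_zpow, ← zpow_natCast (-1 : F), ← zpow_natCast θ, ← zpow_mul]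
  rw [show ∀ a b c g x y : F, a * b * (c * (g * x) * y) = (a * c * g) * (b * x * y) by
      intros; ring, ← zpow_add₀ h1, ← zpow_add₀ h1, ← zpow_add₀ hθ, ← zpow_add₀ hθ]
  have e1 : ((d + j : ℕ) : ℤ) + j + (-(d : ℤ) - 2 * (d - j) * j) = 2 * (j - (d - j) * j) := by
    push_cast
    ring
  have e2 : ((2 : ℕ) : ℤ) * ((d - j) * (j + 1)) + (-(d : ℤ) - 2 * (d - j) * j)
      + (d - 2 * (d - j)) = 0 := by
    push_cast
    ring
  rw [e1, e2, zpow_mul]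
  simp

/-- The inverse of an operator that is the triple sum in `f`, `e`, `f` on each weight space. Its
scalar at `v j` is that of the triple sum in `e`, `f`, `e` at `v (d - j)`. -/
theorem SpannedByStrings.inverse_eq_of_reverse [FiniteDimensional F V] (hq : IsGeneric q) {θ : F}
    (hθ : θ ≠ 0) (hθq : θ ^ 2 = q⁻¹) (t : ℤ) (hV : SpannedByStrings q e f k)
    {T Υ : Module.End F V}
    (hT : ∀ (d : ℕ) (v : ℤ → V), IsString q e f k d v → ∀ j : ℤ,
      T (v j) = tripleSum q f e (2 * j - d) (v j))
    (hΥ : ∀ (d : ℕ) (v : ℤ → V), IsString q e f k d v → ∀ j : ℤ,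
      Υ (v j) = θ⁻¹ ^ (-(((d : ℤ) - 2 * j) ^ 2)) • v j) :
    IsUnit T ∧ Ring.inverse T = expq q (nilZ q θ t e k) *
      (expq q (nilX q θ t f k) * Υ * expq q (nilZ q θ t e k)) := by
  refine hV.isUnit_and_inverse_eq fun d v hs j hj => ?_
  have h := hs.expq_rotator_apply (p := θ⁻¹) hq (by rw [inv_pow, hθq, inv_inv]) hθ t
    (hV.isNilpotent_nilZ hq hθ t) (hV.isNilpotent_nilX hq hθ t) (hΥ d v hs) (Nat.sub_le d j)
  have h' := (hs.reverse hq).tripleSum_apply hq (hV.isNilpotent_f hq) (hV.isNilpotent_e hq)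
    (Nat.sub_le d j)
  rw [show ((d - j : ℕ) : ℤ) = d - j by omega, sub_sub_cancel] at h h'
  rw [show (d : ℤ) - 2 * (d - j) = 2 * j - d by ring] at h'
  rw [hT d v hs, h', map_smul, h, smul_smul]
  have h1 : (-1 : F) ≠ 0 := by simp
  have hq' : q = θ ^ (-2 : ℤ) := by
    rw [zpow_neg, zpow_ofNat, hθq, inv_inv]
  rw [hq', inv_zpow', ← zpow_natCast (-1 : F), ← zpow_mul]
  rw [show ∀ a b c x y : F, a * b * (c * x * y) = (a * c) * (b * x * y) by
      intros; ring, ← zpow_add₀ h1, ← zpow_add₀ hθ, ← zpow_add₀ hθ]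
  have e1 : ((d + (d - j) : ℕ) : ℤ) + j = 2 * d := by omega
  have e2 : -2 * ((j : ℤ) * (d - j + 1)) + -(-(d : ℤ) - 2 * (d - j) * j)
      + (d - 2 * (d - j)) = 0 := by
    ring
  rw [e1, e2, zpow_mul]
  simp

end Spanned

/-! ### Strings span modules of type 1 -/

section TypeOne

variable {F : Type*} [Field F] {q : F} {V : Type*} [AddCommGroup V] [Module F V]
  [Module (Uq F q) V] [IsScalarTower F (Uq F q) V]

variable (q V) in
/-- The generator `k` of `U_q(sl₂)` as an invertible endomorphism of a module. -/
noncomputable def actK : (Module.End F V)ˣ :=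
  Units.map (act q V : Uq F q →* Module.End F V) (Uq.k q)

theorem isString_of_isVd {W : Submodule (Uq F q) V} {d : ℕ} (b : Module.Basis (Fin (d + 1)) F W)
    (hk : ∀ i : Fin (d + 1), (Uq.k q : Uq F q) • b i = (1 * q ^ ((d : ℤ) - 2 * (i : ℤ))) • b i)
    (hf : ∀ i : Fin d, Uq.f q • b i.castSucc = qInt q ((i : ℤ) + 1) • b i.succ)
    (hf' : Uq.f q • b (Fin.last d) = 0)
    (he : ∀ i : Fin d, Uq.e q • b i.succ = (1 * qInt q ((d : ℤ) - (i : ℤ))) • b i.castSucc)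
    (he' : Uq.e q • b 0 = 0) :
    IsString q (act q V (Uq.e q)) (act q V (Uq.f q)) (actK q V) d
      fun i => if h : 0 ≤ i ∧ i ≤ d then (b ⟨i.toNat, by omega⟩ : V) else 0 where
  eq_zero i hi := dif_neg (by omega)
  k_apply i := by
    split_ifs with h
    · have := congrArg (Submodule.subtype W) (hk ⟨i.toNat, by omega⟩)
      dsimp only at this
      rw [Int.toNat_of_nonneg h.1, one_mul] at this
      exact this
    · simp
  e_apply i := by
    by_cases h : 0 ≤ i ∧ i ≤ d
    · rw [dif_pos h]
      by_cases hi : i = 0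
      · subst hi
        rw [dif_neg (by omega), smul_zero]
        exact congrArg (Submodule.subtype W) he'
      · rw [dif_pos (by omega)]
        have := congrArg (Submodule.subtype W) (he ⟨(i - 1).toNat, by omega⟩)
        dsimp only [Fin.succ_mk, Fin.castSucc_mk] at this
        rw [Int.toNat_of_nonneg (by omega), one_mul, show (d : ℤ) - (i - 1) = d - i + 1 by ring]
          at this
        simp only [show (i - 1).toNat + 1 = i.toNat by omega] at this
        exact this
    · rw [dif_neg h, map_zero]
      by_cases hi : i = d + 1
      · subst hi
        rw [show (d : ℤ) - (d + 1) + 1 = 0 by ring, qInt_zero, zero_smul]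
      · rw [dif_neg (by omega), smul_zero]
  f_apply i := by
    by_cases h : 0 ≤ i ∧ i ≤ d
    · rw [dif_pos h]
      by_cases hi : i = d
      · subst hi
        rw [dif_neg (by omega), smul_zero]
        exact congrArg (Submodule.subtype W) hf'
      · rw [dif_pos (by omega)]
        have := congrArg (Submodule.subtype W) (hf ⟨i.toNat, by omega⟩)
        dsimp only [Fin.succ_mk, Fin.castSucc_mk] at this
        rw [Int.toNat_of_nonneg (by omega)] at this
        simp only [show (i + 1).toNat = i.toNat + 1 by omega]
        exact this
    · rw [dif_neg h, map_zero]
      by_cases hi : i = -1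
      · subst hi
        rw [neg_add_cancel, qInt_zero, zero_smul]
      · rw [dif_neg (by omega), smul_zero]

/-- A module of type 1 is spanned by the strings in it. -/
theorem IsTypeOne.spannedByStrings (hV : IsTypeOne q V) :
    SpannedByStrings q (act q V (Uq.e q)) (act q V (Uq.f q)) (actK q V) := by
  intro M hM
  obtain ⟨-, n, W, hW, hi⟩ := hV
  rw [eq_top_iff]
  intro w _
  have hw : w ∈ ⨆ i, W i := by rw [hW.submodule_iSup_eq_top]; trivial
  induction hw using Submodule.iSup_induction' with
  | zero => exact zero_mem _
  | add x y _ _ hx hy => exact add_mem (hx trivial) (hy trivial)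
  | mem i w hw =>
    obtain ⟨-, d, b, hk, hf, hf', he, he'⟩ := hi i
    have hs := isString_of_isVd b hk hf hf' he he'
    have hsum := congrArg (Submodule.subtype (W i)) (b.sum_repr ⟨w, hw⟩)
    rw [map_sum] at hsum
    rw [show w = (W i).subtype ⟨w, hw⟩ from rfl, ← hsum]
    refine sum_mem fun j _ => ?_
    refine (Submodule.smul_mem _ _ ?_ : b.repr ⟨w, hw⟩ j • (b j : V) ∈ M)
    have := hM d _ hs j (by omega)
    rw [dif_pos (by omega)] at this
    simpa using this

end TypeOne

/-! ### The Lusztig operators and the two identifications -/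

section Comparison

variable {F : Type*} [Field F] {q : F} {V : Type*} [AddCommGroup V] [Module F V]
  [Module (Uq F q) V] [IsScalarTower F (Uq F q) V]

theorem actK_zpow (n : ℤ) :
    act q V ((Uq.k q ^ n : (Uq F q)ˣ) : Uq F q) = ((actK q V ^ n : (Module.End F V)ˣ) : _) :=
  map_units_zpow (act q V) rfl n

theorem actK_inv :
    act q V (((Uq.k q)⁻¹ : (Uq F q)ˣ) : Uq F q) = (((actK q V)⁻¹ : (Module.End F V)ˣ) : _) :=
  map_units_inv (act q V) rfl

theorem primaryIdent_x (hq : IsGeneric q) {θ : F} (hθ : θ ≠ 0) (t : ℤ) :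
    primaryIdent hq hθ t (Equitable.x q) = (((Uq.k q)⁻¹ : (Uq F q)ˣ) : Uq F q) -
      (q ^ (1 + t) * (q - q⁻¹) * θ⁻¹) •
        (((Uq.k q ^ (-1 - t) : (Uq F q)ˣ) : Uq F q) * Uq.e q) :=
  Equitable.lift_x _

theorem primaryIdent_y (hq : IsGeneric q) {θ : F} (hθ : θ ≠ 0) (t : ℤ) :
    primaryIdent hq hθ t (Equitable.y q) = Uq.k q :=
  Equitable.lift_y _

theorem primaryIdent_z (hq : IsGeneric q) {θ : F} (hθ : θ ≠ 0) (t : ℤ) :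
    primaryIdent hq hθ t (Equitable.z q) = (((Uq.k q)⁻¹ : (Uq F q)ˣ) : Uq F q) +
      (q ^ (-t) * (q - q⁻¹) * θ) • (Uq.f q * ((Uq.k q ^ t : (Uq F q)ˣ) : Uq F q)) :=
  Equitable.lift_z _

theorem secondaryIdent_x (hq : IsGeneric q) {θ : F} (hθ : θ ≠ 0) (t : ℤ) :
    secondaryIdent hq hθ t (Equitable.x q) = (Uq.k q : Uq F q) -
      (q ^ (1 + t) * (q - q⁻¹) * θ⁻¹) •
        (((Uq.k q ^ (1 + t) : (Uq F q)ˣ) : Uq F q) * Uq.f q) :=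
  Equitable.lift_x _

theorem secondaryIdent_y (hq : IsGeneric q) {θ : F} (hθ : θ ≠ 0) (t : ℤ) :
    secondaryIdent hq hθ t (Equitable.y q) = (((Uq.k q)⁻¹ : (Uq F q)ˣ) : Uq F q) :=
  Equitable.lift_y _

theorem secondaryIdent_z (hq : IsGeneric q) {θ : F} (hθ : θ ≠ 0) (t : ℤ) :
    secondaryIdent hq hθ t (Equitable.z q) = (Uq.k q : Uq F q) +
      (q ^ (-t) * (q - q⁻¹) * θ) • (Uq.e q * ((Uq.k q ^ (-t) : (Uq F q)ˣ) : Uq F q)) :=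
  Equitable.lift_z _

theorem act_primaryIdent_nZ (hq : IsGeneric q) {θ : F} (hθ : θ ≠ 0) (t : ℤ) :
    act q V (primaryIdent hq hθ t (Equitable.nZ q)) = nilZ q θ t (act q V (Uq.e q)) (actK q V) := by
  simp only [Equitable.nZ, map_smul, map_sub, map_one, map_mul, primaryIdent_x, primaryIdent_y,
    actK_zpow, actK_inv]
  rfl

theorem act_primaryIdent_nX (hq : IsGeneric q) {θ : F} (hθ : θ ≠ 0) (t : ℤ) :
    act q V (primaryIdent hq hθ t (Equitable.nX q)) = nilX q θ t (act q V (Uq.f q)) (actK q V) := by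
  simp only [Equitable.nX, map_smul, map_sub, map_add, map_one, map_mul, primaryIdent_y,
    primaryIdent_z, actK_zpow, actK_inv]
  rfl

theorem act_secondaryIdent_nZ (hq : IsGeneric q) {θ : F} (hθ : θ ≠ 0) (t : ℤ) :
    act q V (secondaryIdent hq hθ t (Equitable.nZ q))
      = nilZ q θ t (act q V (Uq.f q)) (actK q V)⁻¹ := by
  rw [nilZ, inv_inv, inv_zpow', show -(-1 - t) = 1 + t by ring]
  simp only [Equitable.nZ, map_smul, map_sub, map_one, map_mul, secondaryIdent_x,
    secondaryIdent_y, actK_zpow, actK_inv]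
  rfl

theorem act_secondaryIdent_nX (hq : IsGeneric q) {θ : F} (hθ : θ ≠ 0) (t : ℤ) :
    act q V (secondaryIdent hq hθ t (Equitable.nX q))
      = nilX q θ t (act q V (Uq.e q)) (actK q V)⁻¹ := by
  rw [nilX, inv_inv, inv_zpow']
  simp only [Equitable.nX, map_smul, map_sub, map_add, map_one, map_mul, secondaryIdent_y,
    secondaryIdent_z, actK_zpow, actK_inv]
  rfl

theorem lusztigSumCheck_eq_tripleSum (l : ℤ) :
    lusztigSumCheck q V l = tripleSum q (act q V (Uq.f q)) (act q V (Uq.e q)) (-l) := by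
  have : {p : ℕ × ℕ × ℕ | (p.1 : ℤ) - (p.2.1 : ℤ) + (p.2.2 : ℤ) = l}
      = {p : ℕ × ℕ × ℕ | (p.2.1 : ℤ) - (p.1 : ℤ) - (p.2.2 : ℤ) = -l} := by
    ext p
    simp only [Set.mem_ofPred_eq]
    omega
  rw [lusztigSumCheck, this, tripleSum]

theorem IsString.mem_weightSpace {d : ℕ} {v : ℤ → V}
    (hs : IsString q (act q V (Uq.e q)) (act q V (Uq.f q)) (actK q V) d v) (i : ℤ) :
    v i ∈ weightSpace q V (d - 2 * i) :=
  QSl2.mem_weightSpace.2 (hs.k_apply i)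

theorem IsString.mem_weightSpace_of_swap (hq : IsGeneric q) {d : ℕ} {v : ℤ → V}
    (hs : IsString q (act q V (Uq.f q)) (act q V (Uq.e q)) (actK q V)⁻¹ d v) (i : ℤ) :
    v i ∈ weightSpace q V (2 * i - d) := by
  have := inv_apply_of_apply (zpow_ne_zero _ hq.ne_zero) (hs.k_apply i)
  rw [inv_inv, ← zpow_neg, neg_sub] at this
  exact QSl2.mem_weightSpace.2 this

end Comparison

end QSl2

theorem theorem9 {F : Type*} [Field F] {q : F} (hq : QSl2.IsGeneric q)
    {θ : F} (hθ : θ ≠ 0) (t : ℤ)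
    {V : Type*} [AddCommGroup V] [Module F V] [Module (QSl2.Uq F q) V]
    [IsScalarTower F (QSl2.Uq F q) V] [FiniteDimensional F V] (hV : QSl2.IsTypeOne q V) :
    (θ ^ 2 = q →
      (IsUnit (QSl2.lusztigT hq hV) ∧ Ring.inverse (QSl2.lusztigT hq hV) =
        QSl2.expq q (QSl2.act q V (QSl2.primaryIdent hq hθ t (QSl2.Equitable.nZ q))) *
          QSl2.rotator hq θ hV (QSl2.primaryIdent hq hθ t)) ∧
      (IsUnit (QSl2.lusztigTCheck hq hV) ∧ Ring.inverse (QSl2.lusztigTCheck hq hV) =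
        QSl2.expq q (QSl2.act q V (QSl2.secondaryIdent hq hθ t (QSl2.Equitable.nZ q))) *
          QSl2.rotator hq θ hV (QSl2.secondaryIdent hq hθ t))) ∧
    (θ ^ 2 = q⁻¹ →
      (IsUnit (QSl2.lusztigTCheck hq hV) ∧ Ring.inverse (QSl2.lusztigTCheck hq hV) =
        QSl2.expq q (QSl2.act q V (QSl2.primaryIdent hq hθ t (QSl2.Equitable.nZ q))) *
          QSl2.rotator hq θ hV (QSl2.primaryIdent hq hθ t)) ∧
      (IsUnit (QSl2.lusztigT hq hV) ∧ Ring.inverse (QSl2.lusztigT hq hV) =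
        QSl2.expq q (QSl2.act q V (QSl2.secondaryIdent hq hθ t (QSl2.Equitable.nZ q))) *
          QSl2.rotator hq θ hV (QSl2.secondaryIdent hq hθ t))) := by
  have hP := hV.spannedByStrings
  have hS := hP.reverse hq
  refine ⟨fun h => ?_, fun h => ?_⟩
  · have hr : QSl2.sqrtq q θ = -θ := if_pos h
    constructor
    · rw [QSl2.rotator, QSl2.act_primaryIdent_nZ, QSl2.act_primaryIdent_nX]
      refine hP.inverse_eq hq hθ h t (fun d v hs j => ?_) (fun d v hs j => ?_)
      · exact QSl2.weightwise_apply hq hV _ (hs.mem_weightSpace j)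
      · rw [QSl2.upsilon, QSl2.weightwise_apply hq hV _ (hs.mem_weightSpace j), hr]
        rfl
    · rw [QSl2.rotator, QSl2.act_secondaryIdent_nZ, QSl2.act_secondaryIdent_nX]
      refine hS.inverse_eq hq hθ h t (fun d v hs j => ?_) (fun d v hs j => ?_)
      · rw [QSl2.lusztigTCheck, QSl2.weightwise_apply hq hV _ (hs.mem_weightSpace_of_swap hq j),
          QSl2.lusztigSumCheck_eq_tripleSum, neg_sub]
      · rw [QSl2.upsilon, QSl2.weightwise_apply hq hV _ (hs.mem_weightSpace_of_swap hq j), hr,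
          sub_sq_comm]
        rfl
  · have hr : QSl2.sqrtq q θ = θ⁻¹ :=
      if_neg fun h' => hq.sub_inv_ne_zero (sub_eq_zero.2 (h'.symm.trans h))
    constructor
    · rw [QSl2.rotator, QSl2.act_primaryIdent_nZ, QSl2.act_primaryIdent_nX]
      refine hP.inverse_eq_of_reverse hq hθ h t (fun d v hs j => ?_) (fun d v hs j => ?_)
      · rw [QSl2.lusztigTCheck, QSl2.weightwise_apply hq hV _ (hs.mem_weightSpace j),
          QSl2.lusztigSumCheck_eq_tripleSum, neg_sub]
      · rw [QSl2.upsilon, QSl2.weightwise_apply hq hV _ (hs.mem_weightSpace j), hr]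
        rfl
    · rw [QSl2.rotator, QSl2.act_secondaryIdent_nZ, QSl2.act_secondaryIdent_nX]
      refine hS.inverse_eq_of_reverse hq hθ h t (fun d v hs j => ?_) (fun d v hs j => ?_)
      · exact QSl2.weightwise_apply hq hV _ (hs.mem_weightSpace_of_swap hq j)
      · rw [QSl2.upsilon, QSl2.weightwise_apply hq hV _ (hs.mem_weightSpace_of_swap hq j), hr,
          sub_sq_comm]
        rfl
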